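/- **Setting.** An *uncertainty space* is a set with an algebra of subsets (its measurable sets); morphisms are maps for which preimages of measurable sets are measurable. An *upper probability measure* on $X$ is the pointwise supremum of a nonempty family of finitely additive probability measures on the algebra of $X$. $\Delta^*X$ is the set of all of them, with the algebra generated by the sets $\beta^{p,q}(U)=\{g : g(U)\ge p,\ 1-g(U^c)\ge q\}$ ($p,q\in[0,1]$, $U$ measurable). *Upper probability polynomial functors* are built from $Id$ and constant functors $M$ by binary products (algebra generated by measurable rectangles), binary coproducts (algebra generated by the images of measurable sets) and $\Delta^*$. Let $T$ be one, and let $\mathsf{Ing}\,T$ be the set of its *ingredients* (the functors in its construction, and $Id$); these are the *sorts*. A *$T$-coalgebra* is a measurable map $\alpha:X\to TX$. **Formulas.** $\bot_S:S$; $\varphi\to\psi:S$ for $\varphi,\psi:S$; $A:M$ for $A\subseteq M$ measurable or a singleton; $[\mathsf{pr}_j]\varphi:S_1\times S_2$ and $[\mathsf{in}_j]\varphi:S_1+S_2$ for $\varphi:S_j$; $[\mathsf{next}]\varphi:Id$ for $\varphi:T$; $[(p,q)]\varphi:\Delta^*S$ for $p,q\in[0,1]$ and $\varphi::S$, where $\varphi::S$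 means that $\varphi:S$ and all constants $A$ in $\varphi$ are measurable. Other connectives are the usual abbreviations, and $u_{\ge p}\varphi=[(p,0)]\varphi$, $l_{\ge p}\varphi=[(0,p)]\varphi$, $u_{\le p}\varphi=[(0,1-p)]\neg\varphi$, $u_{<p}\varphi=\neg[(p,0)]\varphi$. The interpretation $[\![\varphi]\!]^\alpha_S\subseteq SX$ is classical for $\bot,\to$, with $[\![A]\!]=A$; $[\mathsf{pr}_j]\varphi$ holds at $z$ iff $\varphi$ holds at $\pi_j z$; $[\mathsf{in}_j]\varphi$ holds at $z$ iff $z=in_j(y)$ implies that $\varphi$ holds at $y$; $[\![[\mathsf{next}]\varphi]\!]=\alpha^{-1}[\![\varphi]\!]$; $[\![[(p,q)]\varphi]\!]=\beta^{p,q}([\![\varphi]\!])$. $\Gamma\models^\alpha_S\varphi$ means that every $y\in SX$ satisfying all of $\Gamma$ satisfies $\varphi$. **Axioms** ($p,q\in[0,1]$). Boolean tautologies; $\{c\}\to A$ if $c\in A$ and $\{c\}\to\neg A$ if $c\notin A$; $\neg[\kappa]\varphi\to[\kappa]\neg\varphi$ for $\kappa=\mathsf{pr}_j,\mathsf{in}_j,\mathsf{next}$;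 $\neg[\mathsf{pr}_j]\bot$; $\neg[\mathsf{next}]\bot$; $\neg[\mathsf{in}_1]\bot\leftrightarrow[\mathsf{in}_2]\bot$; and, for $\varphi,\psi::S$, $u_{\le p}\varphi\to u_{<q}\varphi$ ($p<q$), $u_{<p}\varphi\to u_{\le p}\varphi$, $l_{\ge1}(\varphi\to\psi)\to(u_{\ge p}\varphi\to u_{\ge p}\psi)$, $[(p,q)]\varphi\leftrightarrow(u_{\ge p}\varphi\wedge l_{\ge q}\varphi)$, and $l_{\ge q}\varphi\leftrightarrow u_{\le 1-q}\neg\varphi$. **Deduction systems.** A *$T$-deduction system* $D$ is a family of relations $\vdash_S$ ($S\in\mathsf{Ing}\,T$) between sets of formulas and formulas of sort $S$ such that, for all sorts concerned in $\mathsf{Ing}\,T$: $\Gamma\vdash_S\varphi$ if $\varphi\in\Gamma$ or $\varphi$ is an axiom; $\{\varphi,\varphi\to\psi\}\vdash_S\psi$; if $\Gamma\vdash_S\lambda$ for all $\lambda\in\Lambda$ and $\Lambda\vdash_S\varphi$ then $\Gamma\vdash_S\varphi$; if $\Gamma\cup\{\varphi\}\vdash_S\psi$ then $\Gamma\vdash_S\varphi\to\psi$;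 if $\vdash_S\varphi$ with $\varphi::S$ then $\vdash_{\Delta^*S}l_{\ge1}\varphi$; $\{\neg\{c\}:c\in M\}\vdash_M\bot$; for $\kappa=\mathsf{pr}_j,\mathsf{in}_j,\mathsf{next}$, if $\Gamma\vdash\varphi$ then $\{[\kappa]\psi:\psi\in\Gamma\}\vdash[\kappa]\varphi$; $\{u_{\ge q}\varphi:q<p\}\vdash_{\Delta^*S}u_{\ge p}\varphi$ and $\{l_{\ge q}\varphi:q<p\}\vdash_{\Delta^*S}l_{\ge p}\varphi$; and the cover rules, where $C_k=\bigvee_{I\subseteq\{1,\dots,m\},|I|=k}\bigwedge_{i\in I}\varphi_i$, $\varphi,\varphi_i::S$, $p_i\in[0,1]$: (1) if $n\ge1$, $\vdash_S\varphi\to C_{n+k}$, $\vdash_S C_k$ and $p=\max(0,\min(1,(\sum_ip_i-k)/n))$, then $\vdash_{\Delta^*S}\bigwedge_iu_{\le p_i}\varphi_i\to u_{\le p}\varphi$; (2) if $\vdash_S C_k$ and $\sum_ip_i<k$, then $\vdash_{\Delta^*S}\neg\bigwedge_iu_{\le p_i}\varphi_i$. A set $x$ of formulas of sort $S$ is *$\vdash_S$-consistent*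 if $x\not\vdash_S\bot_S$, and *$\vdash_S$-maximal* if moreover for each $\varphi$ exactly one of $\varphi,\neg\varphi$ is in $x$. $D$ is *Lindenbaum* if for each sort $S$ every $\vdash_S$-consistent set is contained in a $\vdash_S$-maximal one, and *sound* if $\Gamma\vdash_S\varphi$ implies $\Gamma\models^\alpha_S\varphi$ for all sorts $S$ and all $T$-coalgebras $\alpha$. **Canonical coalgebra.** $X_S$ is the set of $\vdash_S$-maximal sets, with the algebra of the sets $|\varphi|_S=\{x\in X_S:\varphi\in x\}$, $\varphi::S$. Put $[\kappa]^-x=\{\varphi:[\kappa]\varphi\in x\}$. For $x\in X_{\Delta^*S}$ let $g_x$ be the upper probability measure on $X_S$ with $g_x(|\varphi|_S)=\sup\{q\in[0,1]:u_{\ge q}\varphi\in x\}$ for $\varphi::S$. The maps $\mathsf r_S:X_S\to S(X_{Id})$ are measurable and given by: $\mathsf r_{Id}=\mathrm{id}$; $\mathsf r_M(x)=c$ with $\{c\}\in x$; $\mathsf r_{S_1\times S_2}(x)=(\mathsf r_{S_1}([\mathsf{pr}_1]^-x),\mathsf r_{S_2}([\mathsf{pr}_2]^-x))$; $\mathsf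 r_{S_1+S_2}(x)=in_j(\mathsf r_{S_j}([\mathsf{in}_j]^-x))$ for the only $j$ with $\neg[\mathsf{in}_j]\bot\in x$; $\mathsf r_{\Delta^*S}(x)(A)=g_x(\mathsf r_S^{-1}(A))$ for $A$ measurable. The *canonical coalgebra* is $\alpha^D:X_{Id}\to T(X_{Id})$, $\alpha^D(x)=\mathsf r_T([\mathsf{next}]^-x)$. **Theorem (Completeness).** Let $D$ be a Lindenbaum $T$-deduction system. The canonical coalgebra $(X_{Id},\alpha^D)$ is well defined: there is exactly one $T$-coalgebra on $X_{Id}$ of the described form. For every sort $S$, every set $\Gamma$ of formulas of sort $S$ and every $\varphi:S$, $\Gamma\models^{\alpha^D}_S\varphi$ implies $\Gamma\vdash^D_S\varphi$. For $S=Id$ the converse also holds. If $D$ is sound, then for every sort $S$, $\Gamma\models^{\alpha^D}_S\varphi$ if and only if $\Gamma\vdash^D_S\varphi$. -/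

import Mathlib

universe u

/-- An uncertainty space: a set together with an algebra of subsets. -/
structure Unc : Type (u + 1) where
  carrier : Type u
  meas : Set (Set carrier)
  isSetAlgebra : MeasureTheory.IsSetAlgebra meas

namespace Unc

instance : CoeSort Unc.{u} (Type u) := ⟨Unc.carrier⟩

/-- Measurable functions, the morphisms of the category of uncertainty spaces. -/
def IsMeasurable {X Y : Unc.{u}} (f : X → Y) : Prop :=
  ∀ U ∈ Y.meas, f ⁻¹' U ∈ X.meas

/-- The uncertainty space on `α` whose algebra is generated by `F`. -/
@[reducible]
def generate (α : Type u) (F : Set (Set α)) : Unc.{u} :=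
  ⟨α, MeasureTheory.generateSetAlgebra F, MeasureTheory.isSetAlgebra_generateSetAlgebra⟩

/-- The product, with the algebra generated by the measurable rectangles. -/
@[reducible]
def prod (X Y : Unc.{u}) : Unc.{u} :=
  generate (X × Y) {B | ∃ U ∈ X.meas, ∃ V ∈ Y.meas, B = U ×ˢ V}

/-- The coproduct, with the algebra generated by the images of the measurable sets. -/
@[reducible]
def sum (X Y : Unc.{u}) : Unc.{u} :=
  generate (X ⊕ Y) ({B | ∃ U ∈ X.meas, B = Sum.inl '' U} ∪ {B | ∃ V ∈ Y.meas, B = Sum.inr '' V})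

/-- `μ` restricts to a finitely additive probability measure on the algebra of `X`
(its values on other sets are irrelevant). -/
structure IsFinAddProb (X : Unc.{u}) (μ : Set X → ℝ) : Prop where
  nonneg : ∀ U ∈ X.meas, 0 ≤ μ U
  empty : μ ∅ = 0
  univ : μ Set.univ = 1
  union : ∀ U ∈ X.meas, ∀ V ∈ X.meas, Disjoint U V → μ (U ∪ V) = μ U + μ V

/-- Upper probability measures on `X`: upper envelopes of nonempty families of finitely additive
probability measures. They are functions on the algebra of `X`, extended by `0` to all sets. -/
@[ext]
structure UpperProb (X : Unc.{u}) : Type u where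
  toFun : Set X → ℝ
  not_meas : ∀ U, U ∉ X.meas → toFun U = 0
  envelope : ∃ P : Set (Set X → ℝ), P.Nonempty ∧ (∀ μ ∈ P, IsFinAddProb X μ) ∧
    ∀ U ∈ X.meas, IsLUB ((fun μ : Set X → ℝ => μ U) '' P) (toFun U)

/-- `β^{p,q}(U)`; it is only used for measurable `U`. -/
def beta (X : Unc.{u}) (p q : unitInterval) (U : Set X) : Set (UpperProb X) :=
  {g | (p : ℝ) ≤ g.toFun U ∧ (q : ℝ) ≤ 1 - g.toFun Uᶜ}

/-- The space `Δ* X` of upper probability measures. -/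
@[reducible]
def delta (X : Unc.{u}) : Unc.{u} :=
  generate (UpperProb X) {B | ∃ p q : unitInterval, ∃ U ∈ X.meas, B = beta X p q U}

end Unc

/-- Upper probability polynomial functors, the constants being named by labels `k : K`; the
constant functor named `k` has as value the space `M k` of a family `M : K → Unc`. -/
inductive UPFunctor (K : Type u) : Type u
  | id : UPFunctor K
  | const : K → UPFunctor K
  | prod : UPFunctor K → UPFunctor K → UPFunctor K
  | sum : UPFunctor K → UPFunctor K → UPFunctor K
  | delta : UPFunctor K → UPFunctor K

namespace UPFunctor

variable {K : Type u}

/-- The value of the functor on an uncertainty space. -/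
@[reducible]
def obj (M : K → Unc.{u}) (X : Unc.{u}) : UPFunctor K → Unc.{u}
  | id => X
  | const k => M k
  | prod S₁ S₂ => (obj M X S₁).prod (obj M X S₂)
  | sum S₁ S₂ => (obj M X S₁).sum (obj M X S₂)
  | delta S => (obj M X S).delta

/-- The ingredients of a functor: these are the sorts of the modal language. -/
def ing : UPFunctor K → Set (UPFunctor K)
  | id => {id}
  | const k => {const k, id}
  | prod S₁ S₂ => {prod S₁ S₂} ∪ (ing S₁ ∪ ing S₂)
  | sum S₁ S₂ => {sum S₁ S₂} ∪ (ing S₁ ∪ ing S₂)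
  | delta S => {delta S} ∪ ing S

theorem self_mem_ing (T : UPFunctor K) : T ∈ T.ing := by
  cases T <;> simp [ing]

theorem id_mem_ing (T : UPFunctor K) : id ∈ T.ing := by
  induction T <;> simp_all [ing]

theorem ing_trans {R S T : UPFunctor K} (hR : R ∈ S.ing) (hS : S ∈ T.ing) : R ∈ T.ing := by
  induction T with
  | id => simp only [ing, Set.mem_singleton_iff] at hS; subst hS; exact hR
  | const k =>
    simp only [ing, Set.mem_insert_iff, Set.mem_singleton_iff] at hS
    rcases hS with rfl | rfl
    · exact hR
    · simp only [ing, Set.mem_singleton_iff] at hR; subst hR; simp [ing]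
  | prod A B hA hB =>
    rcases hS with hS | hS | hS
    · rw [Set.mem_singleton_iff] at hS; subst hS; exact hR
    · exact Or.inr (Or.inl (hA hS))
    · exact Or.inr (Or.inr (hB hS))
  | sum A B hA hB =>
    rcases hS with hS | hS | hS
    · rw [Set.mem_singleton_iff] at hS; subst hS; exact hR
    · exact Or.inr (Or.inl (hA hS))
    · exact Or.inr (Or.inr (hB hS))
  | delta A hA =>
    rcases hS with hS | hS
    · rw [Set.mem_singleton_iff] at hS; subst hS; exact hR
    · exact Or.inr (hA hS)

theorem prod_left {T S₁ S₂ : UPFunctor K} (h : prod S₁ S₂ ∈ T.ing) : S₁ ∈ T.ing :=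
  ing_trans (S := prod S₁ S₂) (Or.inr (Or.inl (self_mem_ing S₁))) h

theorem prod_right {T S₁ S₂ : UPFunctor K} (h : prod S₁ S₂ ∈ T.ing) : S₂ ∈ T.ing :=
  ing_trans (S := prod S₁ S₂) (Or.inr (Or.inr (self_mem_ing S₂))) h

theorem sum_left {T S₁ S₂ : UPFunctor K} (h : sum S₁ S₂ ∈ T.ing) : S₁ ∈ T.ing :=
  ing_trans (S := sum S₁ S₂) (Or.inr (Or.inl (self_mem_ing S₁))) h

theorem sum_right {T S₁ S₂ : UPFunctor K} (h : sum S₁ S₂ ∈ T.ing) : S₂ ∈ T.ing :=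
  ing_trans (S := sum S₁ S₂) (Or.inr (Or.inr (self_mem_ing S₂))) h

theorem delta_arg {T S : UPFunctor K} (h : delta S ∈ T.ing) : S ∈ T.ing :=
  ing_trans (S := delta S) (Or.inr (self_mem_ing S)) h

end UPFunctor

/-- A `T`-coalgebra structure on `X`: a measurable map `X → T X`. -/
@[ext]
structure Coalg {K : Type u} (M : K → Unc.{u}) (T : UPFunctor K) (X : Unc.{u}) : Type u where
  toFun : X → T.obj M X
  measurable : Unc.IsMeasurable toFun

/-- Formulas by sort. `Form M T false S` consists of all formulas of sort `S`, and `Form M T true S`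
of the measurable ones, in which all constants `A` are measurable sets. In general a constant
`A` of sort `M k` is a measurable set or a singleton. The operators `[(p,q)]` apply to measurable
formulas only. -/
inductive Form {K : Type u} (M : K → Unc.{u}) (T : UPFunctor K) : Bool → UPFunctor K → Type u
  | bot {b : Bool} {S : UPFunctor K} : Form M T b S
  | imp {b : Bool} {S : UPFunctor K} : Form M T b S → Form M T b S → Form M T b S
  | const {b : Bool} {k : K} (A : Set (M k))
      (hA : A ∈ (M k).meas ∨ (b = false ∧ ∃ c, A = {c})) : Form M T b (.const k)
  | pr₁ {b : Bool} {S₁ S₂ : UPFunctor K} : Form M T b S₁ → Form M T b (.prod S₁ S₂)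
  | pr₂ {b : Bool} {S₁ S₂ : UPFunctor K} : Form M T b S₂ → Form M T b (.prod S₁ S₂)
  | in₁ {b : Bool} {S₁ S₂ : UPFunctor K} : Form M T b S₁ → Form M T b (.sum S₁ S₂)
  | in₂ {b : Bool} {S₁ S₂ : UPFunctor K} : Form M T b S₂ → Form M T b (.sum S₁ S₂)
  | next {b : Bool} : Form M T b T → Form M T b .id
  | box {b : Bool} {S : UPFunctor K} (p q : unitInterval) : Form M T true S → Form M T b (.delta S)

namespace Form

variable {K : Type u} {M : K → Unc.{u}} {T : UPFunctor K} {b : Bool} {S : UPFunctor K}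

/-- The inclusion of (measurable) formulas into all formulas. -/
def incl {b : Bool} {S : UPFunctor K} : Form M T b S → Form M T false S
  | bot => bot
  | imp φ ψ => imp φ.incl ψ.incl
  | const A hA => const A (hA.imp_right fun h => ⟨rfl, h.2⟩)
  | pr₁ φ => pr₁ φ.incl
  | pr₂ φ => pr₂ φ.incl
  | in₁ φ => in₁ φ.incl
  | in₂ φ => in₂ φ.incl
  | next φ => next φ.incl
  | box p q φ => box p q φ

/-- The constant formula `{c}`. -/
def single {k : K} (c : M k) : Form M T false (.const k) := const {c} (Or.inr ⟨rfl, c, rfl⟩)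

def neg (φ : Form M T b S) : Form M T b S := imp φ bot
def top : Form M T b S := neg bot
def or (φ ψ : Form M T b S) : Form M T b S := imp (neg φ) ψ
def and (φ ψ : Form M T b S) : Form M T b S := neg (or (neg φ) (neg ψ))
def iff (φ ψ : Form M T b S) : Form M T b S := and (imp φ ψ) (imp ψ φ)

/-- Conjunction and disjunction of finite lists of formulas. -/
def bigAnd : List (Form M T b S) → Form M T b S
  | [] => top
  | φ :: l => and φ (bigAnd l)

def bigOr : List (Form M T b S) → Form M T b S
  | [] => bot
  | φ :: l => or φ (bigOr l)

/-- The formula `⋁_{I ⊆ {1,…,m}, |I| = k} ⋀_{i ∈ I} φᵢ`. -/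
def atLeast {m : ℕ} (k : ℕ) (φ : Fin m → Form M T b S) : Form M T b S :=
  bigOr (((List.finRange m).sublistsLen k).map fun J => bigAnd (J.map φ))

/-- `upper ≥ p`, `lower ≥ p`, `upper ≤ p` and `upper < p`. -/
def upperGE (p : unitInterval) (φ : Form M T true S) : Form M T b (.delta S) := box p 0 φ
def lowerGE (p : unitInterval) (φ : Form M T true S) : Form M T b (.delta S) := box 0 p φ
def upperLE (p : unitInterval) (φ : Form M T true S) : Form M T b (.delta S) :=
  box 0 (unitInterval.symm p) (neg φ)
def upperLT (p : unitInterval) (φ : Form M T true S) : Form M T b (.delta S) := neg (box p 0 φ)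

/-- The interpretation of a formula of sort `S` in a coalgebra on `X`, as a subset of `S X`. -/
def sem {X : Unc.{u}} (α : Coalg M T X) {b : Bool} {S : UPFunctor K} :
    Form M T b S → Set (S.obj M X)
  | bot => ∅
  | imp φ ψ => (sem α φ)ᶜ ∪ sem α ψ
  | const A _ => A
  | pr₁ φ => {z | z.1 ∈ sem α φ}
  | pr₂ φ => {z | z.2 ∈ sem α φ}
  | in₁ φ => Sum.inl '' sem α φ ∪ Set.range Sum.inr
  | in₂ φ => Set.range Sum.inl ∪ Sum.inr '' sem α φ
  | next φ => α.toFun ⁻¹' sem α φ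
  | box p q φ => Unc.beta _ p q (sem α φ)

/-- `Γ ⊨_S^α φ`. -/
def Entails {X : Unc.{u}} (α : Coalg M T X) (Γ : Set (Form M T false S))
    (φ : Form M T false S) : Prop :=
  ∀ y : S.obj M X, (∀ ψ ∈ Γ, y ∈ sem α ψ) → y ∈ sem α φ

/-- Boolean tautologies: formulas that are true under every valuation of the formulas of sort `S`
respecting `⊥` and `→`. -/
def IsTautology (φ : Form M T false S) : Prop :=
  ∀ v : Form M T false S → Prop, ¬ v bot → (∀ χ ψ, v (imp χ ψ) ↔ (v χ → v ψ)) → v φ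

/-- The axioms, by sort. The last one expresses that `lower ≥ q` of `φ` and
`upper ≤ 1 - q` of `¬ φ` are interchangeable. -/
inductive IsAxiom : {S : UPFunctor K} → Form M T false S → Prop
  | taut {S : UPFunctor K} (φ : Form M T false S) : IsTautology φ → IsAxiom φ
  | const_mem {k : K} (A : Set (M k)) (hA) (c : M k) :
      c ∈ A → IsAxiom (imp (single c) (const A hA))
  | const_not_mem {k : K} (A : Set (M k)) (hA) (c : M k) :
      c ∉ A → IsAxiom (imp (single c) (neg (const A hA)))
  | pr₁_neg {S₁ S₂ : UPFunctor K} (φ : Form M T false S₁) :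
      IsAxiom (S := .prod S₁ S₂) (imp (neg (pr₁ φ)) (pr₁ (neg φ)))
  | pr₂_neg {S₁ S₂ : UPFunctor K} (φ : Form M T false S₂) :
      IsAxiom (S := .prod S₁ S₂) (imp (neg (pr₂ φ)) (pr₂ (neg φ)))
  | pr₁_bot {S₁ S₂ : UPFunctor K} : IsAxiom (S := .prod S₁ S₂) (neg (pr₁ bot))
  | pr₂_bot {S₁ S₂ : UPFunctor K} : IsAxiom (S := .prod S₁ S₂) (neg (pr₂ bot))
  | in₁_neg {S₁ S₂ : UPFunctor K} (φ : Form M T false S₁) :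
      IsAxiom (S := .sum S₁ S₂) (imp (neg (in₁ φ)) (in₁ (neg φ)))
  | in₂_neg {S₁ S₂ : UPFunctor K} (φ : Form M T false S₂) :
      IsAxiom (S := .sum S₁ S₂) (imp (neg (in₂ φ)) (in₂ (neg φ)))
  | in_bot {S₁ S₂ : UPFunctor K} : IsAxiom (S := .sum S₁ S₂) (iff (neg (in₁ bot)) (in₂ bot))
  | next_neg (φ : Form M T false T) : IsAxiom (imp (neg (next φ)) (next (neg φ)))
  | next_bot : IsAxiom (neg (next bot))
  | upper_le_lt {S : UPFunctor K} (φ : Form M T true S) (p q : unitInterval) :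
      p < q → IsAxiom (imp (upperLE p φ) (upperLT q φ))
  | upper_lt_le {S : UPFunctor K} (φ : Form M T true S) (p : unitInterval) :
      IsAxiom (imp (upperLT p φ) (upperLE p φ))
  | lower_imp {S : UPFunctor K} (φ ψ : Form M T true S) (p : unitInterval) :
      IsAxiom (imp (lowerGE 1 (imp φ ψ)) (imp (upperGE p φ) (upperGE p ψ)))
  | box_iff {S : UPFunctor K} (φ : Form M T true S) (p q : unitInterval) :
      IsAxiom (iff (box p q φ) (and (upperGE p φ) (lowerGE q φ)))
  | lower_dual {S : UPFunctor K} (φ : Form M T true S) (q : unitInterval) :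
      IsAxiom (iff (lowerGE q φ) (upperLE (unitInterval.symm q) (neg φ)))

end Form

open Form in
/-- A `T`-deduction system: a family of relations `⊢_S`, for `S` an ingredient of `T`, that
satisfies the listed rules. -/
structure DeductionSystem {K : Type u} (M : K → Unc.{u}) (T : UPFunctor K) : Type u where
  Derives : {S : UPFunctor K} → S ∈ T.ing → Set (Form M T false S) → Form M T false S → Prop
  assumption : ∀ {S} (hS : S ∈ T.ing) (Γ : Set (Form M T false S)) (φ),
    (φ ∈ Γ ∨ IsAxiom φ) → Derives hS Γ φ
  modus_ponens : ∀ {S} (hS : S ∈ T.ing) (φ ψ : Form M T false S), Derives hS {φ, imp φ ψ} ψ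
  cut : ∀ {S} (hS : S ∈ T.ing) (Γ Λ : Set (Form M T false S)) (φ),
    (∀ ψ ∈ Λ, Derives hS Γ ψ) → Derives hS Λ φ → Derives hS Γ φ
  deduction : ∀ {S} (hS : S ∈ T.ing) (Γ : Set (Form M T false S)) (φ ψ),
    Derives hS (Γ ∪ {φ}) ψ → Derives hS Γ (imp φ ψ)
  necessitation : ∀ {S} (h : .delta S ∈ T.ing) (φ : Form M T true S),
    Derives (UPFunctor.delta_arg h) ∅ φ.incl → Derives h ∅ (lowerGE 1 φ)
  constant : ∀ {k} (h : .const k ∈ T.ing), Derives h (Set.range fun c : M k => neg (single c)) bot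
  box_pr₁ : ∀ {S₁ S₂} (h : .prod S₁ S₂ ∈ T.ing) (Γ : Set (Form M T false S₁)) (φ),
    Derives (UPFunctor.prod_left h) Γ φ → Derives h (pr₁ '' Γ) (pr₁ φ)
  box_pr₂ : ∀ {S₁ S₂} (h : .prod S₁ S₂ ∈ T.ing) (Γ : Set (Form M T false S₂)) (φ),
    Derives (UPFunctor.prod_right h) Γ φ → Derives h (pr₂ '' Γ) (pr₂ φ)
  box_in₁ : ∀ {S₁ S₂} (h : .sum S₁ S₂ ∈ T.ing) (Γ : Set (Form M T false S₁)) (φ),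
    Derives (UPFunctor.sum_left h) Γ φ → Derives h (in₁ '' Γ) (in₁ φ)
  box_in₂ : ∀ {S₁ S₂} (h : .sum S₁ S₂ ∈ T.ing) (Γ : Set (Form M T false S₂)) (φ),
    Derives (UPFunctor.sum_right h) Γ φ → Derives h (in₂ '' Γ) (in₂ φ)
  box_next : ∀ (Γ : Set (Form M T false T)) (φ),
    Derives T.self_mem_ing Γ φ → Derives T.id_mem_ing (next '' Γ) (next φ)
  archimedean_upper : ∀ {S} (h : .delta S ∈ T.ing) (φ : Form M T true S) (p : unitInterval),
    Derives h {χ | ∃ q < p, χ = upperGE q φ} (upperGE p φ)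
  archimedean_lower : ∀ {S} (h : .delta S ∈ T.ing) (φ : Form M T true S) (p : unitInterval),
    Derives h {χ | ∃ q < p, χ = lowerGE q φ} (lowerGE p φ)
  cover₁ : ∀ {S} (h : .delta S ∈ T.ing) (m n k : ℕ) (φ : Form M T true S)
    (φs : Fin m → Form M T true S) (ps : Fin m → unitInterval) (p : unitInterval), 1 ≤ n →
    Derives (UPFunctor.delta_arg h) ∅ (imp φ (atLeast (n + k) φs)).incl →
    Derives (UPFunctor.delta_arg h) ∅ (atLeast k φs).incl →
    (p : ℝ) = max 0 (min 1 (((∑ i, (ps i : ℝ)) - k) / n)) →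
    Derives h ∅ (imp (bigAnd (List.ofFn fun i => upperLE (ps i) (φs i))) (upperLE p φ))
  cover₂ : ∀ {S} (h : .delta S ∈ T.ing) (m k : ℕ)
    (φs : Fin m → Form M T true S) (ps : Fin m → unitInterval),
    Derives (UPFunctor.delta_arg h) ∅ (atLeast k φs).incl →
    (∑ i, (ps i : ℝ)) < k →
    Derives h ∅ (neg (bigAnd (List.ofFn fun i => upperLE (ps i) (φs i))))

namespace DeductionSystem

open Form

variable {K : Type u} {M : K → Unc.{u}} {T : UPFunctor K} (D : DeductionSystem M T)
  {S : UPFunctor K} (hS : S ∈ T.ing)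

def Consistent (x : Set (Form M T false S)) : Prop := ¬ D.Derives hS x bot

/-- `⊢_S`-maximal sets: negation complete and consistent. -/
def Maximal (x : Set (Form M T false S)) : Prop :=
  (∀ φ, φ ∈ x ↔ neg φ ∉ x) ∧ D.Consistent hS x

/-- The Lindenbaum property. -/
def Lindenbaum : Prop :=
  ∀ {S : UPFunctor K} (hS : S ∈ T.ing) (Γ : Set (Form M T false S)),
    D.Consistent hS Γ → ∃ x, Γ ⊆ x ∧ D.Maximal hS x

/-- Soundness with respect to all `T`-coalgebras. -/
def Sound : Prop :=
  ∀ {S : UPFunctor K} (hS : S ∈ T.ing) (Γ : Set (Form M T false S)) (φ : Form M T false S),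
    D.Derives hS Γ φ → ∀ (X : Unc.{u}) (α : Coalg M T X), Entails α Γ φ

variable {D} {hS}

theorem Maximal.closed {x : Set (Form M T false S)} (hx : D.Maximal hS x)
    {φ : Form M T false S} (h : D.Derives hS x φ) : φ ∈ x := by
  rw [hx.1]
  intro hn
  refine hx.2 (D.cut hS x {φ, imp φ bot} bot ?_ (D.modus_ponens hS φ bot))
  rintro ψ (rfl | rfl)
  · exact h
  · exact D.assumption hS _ _ (Or.inl hn)

theorem Maximal.imp_iff {x : Set (Form M T false S)} (hx : D.Maximal hS x)
    (φ ψ : Form M T false S) : imp φ ψ ∈ x ↔ (φ ∈ x → ψ ∈ x) := by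
  have mp : ∀ {χ ξ : Form M T false S}, imp χ ξ ∈ x → χ ∈ x → ξ ∈ x := by
    intro χ ξ h h'
    refine hx.closed (D.cut hS x {χ, imp χ ξ} ξ ?_ (D.modus_ponens hS χ ξ))
    rintro θ (rfl | rfl)
    · exact D.assumption hS _ _ (Or.inl h')
    · exact D.assumption hS _ _ (Or.inl h)
  refine ⟨mp, fun h => ?_⟩
  by_cases hφ : φ ∈ x
  · refine mp (hx.closed (D.assumption hS _ (imp ψ (imp φ ψ)) (Or.inr (.taut _ ?_)))) (h hφ)
    intro v _ hv
    simp only [hv]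
    tauto
  · have hn : neg φ ∈ x := by
      by_contra hc
      exact hφ ((hx.1 φ).2 hc)
    refine mp (hx.closed
      (D.assumption hS _ (imp (neg φ) (imp φ ψ)) (Or.inr (.taut _ ?_)))) hn
    intro v hb hv
    simp only [neg, hv]
    tauto

variable (D) (hS)

/-- The space `X_S^D` of maximal sets, with the algebra of the sets `|φ|_S`, `φ` measurable. -/
def canonSpace : Unc.{u} where
  carrier := {x : Set (Form M T false S) // D.Maximal hS x}
  meas := {B | ∃ φ : Form M T true S, B = {x | φ.incl ∈ x.1}}
  isSetAlgebra :=
    { empty_mem := by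
        refine ⟨bot, ?_⟩
        ext x
        simp only [Set.mem_empty_iff_false, Set.mem_ofPred_eq, false_iff]
        exact fun h => x.2.2 (D.assumption hS _ _ (Or.inl h))
      compl_mem := by
        rintro _ ⟨φ, rfl⟩
        refine ⟨neg φ, ?_⟩
        ext x
        have := x.2.1 φ.incl
        change ¬ φ.incl ∈ x.1 ↔ neg φ.incl ∈ x.1
        tauto
      union_mem := by
        rintro _ _ ⟨φ, rfl⟩ ⟨ψ, rfl⟩
        refine ⟨or φ ψ, ?_⟩
        ext x
        have h1 := x.2.1 φ.incl
        have h2 := x.2.imp_iff (neg φ.incl) ψ.incl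
        change (φ.incl ∈ x.1 ∨ ψ.incl ∈ x.1) ↔ imp (neg φ.incl) ψ.incl ∈ x.1
        tauto }

/-- The set `|φ|_S` of the maximal sets that contain the measurable formula `φ`. -/
def ext (φ : Form M T true S) : Set (D.canonSpace hS) := {x | φ.incl ∈ x.1}

/-- The space `X_Id^D`. -/
abbrev canonId : Unc.{u} := D.canonSpace T.id_mem_ing

/-- `g` is the canonical measure `g_x` of a maximal set `x` of sort `Δ* S`. -/
def IsCanonMeasure (h : .delta S ∈ T.ing) (x : D.canonSpace h)
    (g : Unc.UpperProb (D.canonSpace (UPFunctor.delta_arg h))) : Prop :=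
  ∀ φ : Form M T true S,
    g.toFun (D.ext _ φ) = sSup {t : ℝ | ∃ q : unitInterval, t = q ∧ upperGE q φ ∈ x.1}

/-- The recursive clauses defining the measurable maps `r_S : X_S → S (X_Id)`, where
`r_{S₁ × S₂} x = (r_{S₁} ([pr₁]⁻ x), r_{S₂} ([pr₂]⁻ x))`, `r_{S₁ + S₂} x = in_j (r_{S_j} ([in_j]⁻ x))`
for the index `j` with `¬ [in_j] ⊥ ∈ x`, and `r_{Δ* S} x = Δ* r_S (g_x)`. -/
structure IsCanonMap
    (r : ∀ {S : UPFunctor K} (hS : S ∈ T.ing), D.canonSpace hS → S.obj M D.canonId) : Prop where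
  measurable : ∀ {S} (hS : S ∈ T.ing), Unc.IsMeasurable (r hS)
  id : ∀ x : D.canonId, r (S := .id) T.id_mem_ing x = x
  const : ∀ {k} (h : .const k ∈ T.ing) (x : D.canonSpace h),
    single (M := M) (k := k) (r (S := .const k) h x) ∈ x.1
  prod : ∀ {S₁ S₂} (h : .prod S₁ S₂ ∈ T.ing) (x : D.canonSpace h),
    ∃ (y₁ : D.canonSpace (UPFunctor.prod_left h)) (y₂ : D.canonSpace (UPFunctor.prod_right h)),
      y₁.1 = {φ | pr₁ φ ∈ x.1} ∧ y₂.1 = {φ | pr₂ φ ∈ x.1} ∧ r (S := .prod S₁ S₂) h x = (r _ y₁, r _ y₂)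
  sum : ∀ {S₁ S₂} (h : .sum S₁ S₂ ∈ T.ing) (x : D.canonSpace h),
    (neg (in₁ bot) ∈ x.1 ∧ neg (in₂ bot) ∉ x.1 ∧
      ∃ y : D.canonSpace (UPFunctor.sum_left h),
        y.1 = {φ | in₁ φ ∈ x.1} ∧ r (S := .sum S₁ S₂) h x = Sum.inl (r _ y)) ∨
    (neg (in₂ bot) ∈ x.1 ∧ neg (in₁ bot) ∉ x.1 ∧
      ∃ y : D.canonSpace (UPFunctor.sum_right h),
        y.1 = {φ | in₂ φ ∈ x.1} ∧ r (S := .sum S₁ S₂) h x = Sum.inr (r _ y))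
  delta : ∀ {S} (h : .delta S ∈ T.ing) (x : D.canonSpace h),
    ∃ g : Unc.UpperProb (D.canonSpace (UPFunctor.delta_arg h)), D.IsCanonMeasure h x g ∧
      ∀ A ∈ (S.obj M D.canonId).meas,
        Unc.UpperProb.toFun (r (S := .delta S) h x) A = g.toFun (r (UPFunctor.delta_arg h) ⁻¹' A)

/-- `α` is the canonical coalgebra structure on `X_Id^D`: it sends `x` to `r_T ([next]⁻ x)`. -/
def IsCanonCoalg (α : Coalg M T D.canonId) : Prop :=
  ∃ r : ∀ {S : UPFunctor K} (hS : S ∈ T.ing), D.canonSpace hS → S.obj M D.canonId,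
    D.IsCanonMap r ∧ ∀ x : D.canonId, ∃ y : D.canonSpace T.self_mem_ing,
      y.1 = {φ | next φ ∈ x.1} ∧ α.toFun x = r T.self_mem_ing y

end DeductionSystem

/-! A maximal set `x` of sort `S` describes a point completely. The maps `r_S` turn it into a point
of `S (X_Id)` satisfying exactly the formulas in `x`; this is the truth lemma
`IsCanonMap.mem_sem_iff`. Completeness follows: if `Γ` does not derive `φ`, the Lindenbaum property
gives a maximal `x ⊇ Γ` without `φ`, and `r_S x` refutes the entailment.

The difficult sort is `Δ* S`, where the numbers `canonVal x φ` read off from `x` must form an upper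
envelope of finitely additive probabilities. The criterion is `CoverBound`: whenever `n 1_A + k ≤ ∑
1_{A_i}` pointwise, also `n g(A) + k ≤ ∑ g(A_i)`. The cover rules yield it (`canonVal_cover`),
because `atLeast k` counts how many of its formulas a maximal set contains and Lindenbaum makes
every inequality valid on all maximal sets derivable. That the criterion suffices is a Hahn–Banach
argument: rounding passes from integer to real coefficients (`CoverBound.real`), and the M. Riesz
extension theorem then gives, for each `A`, an additive probability below `g` that agrees with `g`
at `A`.

Since the measurable subsets of `X_S` are exactly the sets `|φ|`, measurability of `r_S` means that
preimages are definable by formulas. The clauses for `r_S` determine it by induction on `S`, which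
gives uniqueness of the coalgebra. -/

namespace Unc

variable {X : Unc.{u}}

/-! ### Upper envelopes from cover bounds -/

theorem univ_mem_meas (X : Unc.{u}) : Set.univ ∈ X.meas := by
  simpa using X.isSetAlgebra.compl_mem X.isSetAlgebra.empty_mem

/-- The number of times that a point is covered by a family of sets bounds the values of `g`. -/
def CoverBound (X : Unc.{u}) (g : Set X → ℝ) : Prop :=
  ∀ (m n k : ℕ) (A : Set X) (As : Fin m → Set X), A ∈ X.meas → (∀ i, As i ∈ X.meas) →
    (∀ x, (n : ℝ) * A.indicator 1 x + k ≤ ∑ i, (As i).indicator (1 : X → ℝ) x) →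
    (n : ℝ) * g A + k ≤ ∑ i, g (As i)

/-- Formal linear combinations of measurable sets. -/
abbrev Comb (X : Unc.{u}) : Type u := X.meas →₀ ℝ

/-- The extension of a set function to formal combinations. -/
noncomputable def combVal (g : Set X → ℝ) : Comb X →ₗ[ℝ] ℝ :=
  Finsupp.linearCombination ℝ fun U : X.meas => g U.1

theorem combVal_single (g : Set X → ℝ) (U : X.meas) (a : ℝ) :
    combVal g (Finsupp.single U a) = a * g U.1 := by
  simp [combVal]

/-- The value at a point of the step function given by a formal combination. -/
noncomputable abbrev combAt (x : X) : Comb X →ₗ[ℝ] ℝ := combVal fun U => U.indicator 1 x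

theorem CoverBound.fintype {g : Set X → ℝ} (hg : CoverBound X g) {ι : Type*} [Fintype ι]
    (n k : ℕ) {A : Set X} (As : ι → Set X) (hA : A ∈ X.meas) (hAs : ∀ i, As i ∈ X.meas)
    (h : ∀ x, (n : ℝ) * A.indicator 1 x + k ≤ ∑ i, (As i).indicator (1 : X → ℝ) x) :
    (n : ℝ) * g A + k ≤ ∑ i, g (As i) := by
  have e := Fintype.equivFin ι
  have := hg (Fintype.card ι) n k A (As ∘ e.symm) hA (fun i => hAs _) (fun x => by
    refine (h x).trans_eq ?_
    exact (Equiv.sum_comp e.symm fun i => (As i).indicator (1 : X → ℝ) x).symm)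
  exact this.trans_eq (Equiv.sum_comp e.symm fun i => g (As i))

/-- Natural weights are multiplicities: each `U` is listed `w U` times, indexed by a sigma type. -/
theorem CoverBound.weighted {g : Set X → ℝ} (hg : CoverBound X g) (s : Finset X.meas)
    (w : X.meas → ℕ) (n k : ℕ) {A : Set X} (hA : A ∈ X.meas)
    (h : ∀ x, (n : ℝ) * A.indicator 1 x + k ≤ ∑ U ∈ s, (w U : ℝ) * U.1.indicator 1 x) :
    (n : ℝ) * g A + k ≤ ∑ U ∈ s, (w U : ℝ) * g U.1 := by
  have key : ∀ f : Set X → ℝ, ∑ i : (Σ U : s, Fin (w U.1)), f i.1.1.1 =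
      ∑ U ∈ s, (w U : ℝ) * f U.1 := by
    intro f
    rw [Fintype.sum_sigma, ← Finset.sum_coe_sort s]
    simp
  rw [← key]
  refine hg.fintype n k (fun i : (Σ U : s, Fin (w U.1)) => i.1.1.1) hA (fun i => i.1.1.2) ?_
  intro x
  rw [key fun U => U.indicator 1 x]
  exact h x

/-- Scale by `N`, round down on the left and up on the right, and apply the integer bound. The
rounding error does not depend on `N`, so a strict violation would be exceeded for large `N`. -/
theorem CoverBound.real_of_nonneg {g : Set X → ℝ} (hg : CoverBound X g)
    (h0 : ∀ U ∈ X.meas, 0 ≤ g U) (c : Comb X) (hc : 0 ≤ c) {a t : ℝ} (ha : 0 ≤ a) (ht : 0 ≤ t)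
    {A : Set X} (hA : A ∈ X.meas) (h : ∀ x, a * A.indicator 1 x + t ≤ combAt x c) :
    a * g A + t ≤ combVal g c := by
  have hsum : ∀ f : Set X → ℝ, combVal f c = ∑ U ∈ c.support, c U * f U.1 := fun f => by
    simp [combVal, Finsupp.linearCombination_apply, Finsupp.sum]
  have key : ∀ N : ℕ, (N : ℝ) * (a * g A + t - combVal g c) ≤
      g A + 1 + ∑ U ∈ c.support, g U.1 := by
    intro N
    have hN : (0 : ℝ) ≤ N := N.cast_nonneg
    have h1 := hg.weighted c.support (fun U => ⌈(N : ℝ) * c U⌉₊) ⌊(N : ℝ) * a⌋₊ ⌊(N : ℝ) * t⌋₊ hA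
      (fun x => by
        have hx := mul_le_mul_of_nonneg_left (h x) hN
        rw [hsum, Finset.mul_sum] at hx
        have hi : ∀ U : Set X, (0 : ℝ) ≤ U.indicator 1 x := fun U =>
          Set.indicator_nonneg (fun _ _ => zero_le_one) x
        calc _ ≤ (N : ℝ) * a * A.indicator 1 x + N * t := by
              gcongr
              · exact hi A
              · exact Nat.floor_le (by positivity)
              · exact Nat.floor_le (by positivity)
          _ = N * (a * A.indicator 1 x + t) := by ring
          _ ≤ _ := hx
          _ ≤ _ := by
              refine Finset.sum_le_sum fun U _ => ?_
              rw [← mul_assoc]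
              exact mul_le_mul_of_nonneg_right (Nat.le_ceil _) (hi _))
    have h2 : ∑ U ∈ c.support, (⌈(N : ℝ) * c U⌉₊ : ℝ) * g U.1 ≤
        N * combVal g c + ∑ U ∈ c.support, g U.1 := by
      rw [hsum, Finset.mul_sum, ← Finset.sum_add_distrib]
      refine Finset.sum_le_sum fun U _ => ?_
      have := (Nat.ceil_lt_add_one (mul_nonneg hN (hc U))).le
      have := mul_le_mul_of_nonneg_right this (h0 U.1 U.2)
      linarith
    have h3 := mul_le_mul_of_nonneg_right (Nat.lt_floor_add_one ((N : ℝ) * a)).le (h0 A hA)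
    have h4 := Nat.lt_floor_add_one ((N : ℝ) * t)
    linarith
  by_contra hlt
  push Not at hlt
  obtain ⟨N, hN⟩ := Archimedean.arch (g A + 1 + ∑ U ∈ c.support, g U.1 + 1)
    (sub_pos.2 hlt)
  have := key N
  rw [nsmul_eq_mul] at hN
  linarith

/-- Negative parts of `a` and `t` are moved to the right-hand side as multiples of `A` and of the
whole space; `g Set.univ = 1` makes the latter contribute exactly its coefficient. -/
theorem CoverBound.real {g : Set X → ℝ} (hg : CoverBound X g)
    (h0 : ∀ U ∈ X.meas, 0 ≤ g U) (h1 : g Set.univ = 1) (c : Comb X) (hc : 0 ≤ c) {a t : ℝ}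
    {A : Set X} (hA : A ∈ X.meas) (h : ∀ x, a * A.indicator 1 x + t ≤ combAt x c) :
    a * g A + t ≤ combVal g c := by
  have hs : ∀ (r : ℝ) (U : X.meas), 0 ≤ Finsupp.single U (max r 0) := fun r U =>
    Finsupp.single_nonneg.2 (le_max_right _ _)
  have := hg.real_of_nonneg h0 (c + Finsupp.single ⟨A, hA⟩ (max (-a) 0) +
    Finsupp.single ⟨_, X.univ_mem_meas⟩ (max (-t) 0)) (add_nonneg (add_nonneg hc (hs _ _)) (hs _ _))
    (le_max_right a 0) (le_max_right t 0) hA (fun x => by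
      have hx := h x
      simp only [map_add, combVal_single, Set.indicator_univ, Pi.one_apply]
      have e1 := max_zero_sub_max_neg_zero_eq_self a
      have e2 := max_zero_sub_max_neg_zero_eq_self t
      nth_rw 1 [← e1] at hx
      nth_rw 1 [← e2] at hx
      linarith)
  simp only [map_add, combVal_single, h1] at this
  have e1 := max_zero_sub_max_neg_zero_eq_self a
  have e2 := max_zero_sub_max_neg_zero_eq_self t
  nth_rw 1 [← e1]
  nth_rw 1 [← e2]
  linarith

/-- The formal combinations on which every additive probability dominated by `g` is nonnegative. -/
def dominationCone (g : Set X → ℝ) : PointedCone ℝ (Comb X) where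
  -- The condition says that `e` dominates `g(c) - c` pointwise. For an additive probability `μ ≤ g`
  -- this gives `μ(e) ≥ g(c) - μ(c) ≥ 0`.
  carrier := {e | ∃ c : Comb X, 0 ≤ c ∧ ∀ x, combVal g c ≤ combAt x e + combAt x c}
  zero_mem' := ⟨0, le_rfl, fun x => by simp⟩
  smul_mem' := by
    rintro ⟨r, hr⟩ e ⟨c, hc, h⟩
    refine ⟨r • c, smul_nonneg hr hc, fun x => ?_⟩
    change combVal g (r • c) ≤ combAt x (r • e) + combAt x (r • c)
    simp only [map_smul, smul_eq_mul, ← mul_add]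
    exact mul_le_mul_of_nonneg_left (h x) hr
  add_mem' := by
    rintro e e' ⟨c, hc, h⟩ ⟨c', hc', h'⟩
    refine ⟨c + c', add_nonneg hc hc', fun x => ?_⟩
    simp only [map_add]
    linarith [h x, h' x]

theorem mem_dominationCone_of_nonneg (g : Set X → ℝ) {e : Comb X} (h : ∀ x, 0 ≤ combAt x e) :
    e ∈ dominationCone g :=
  ⟨0, le_rfl, fun x => by simpa using h x⟩

/-- Step functions are bounded below, so a multiple of the constant function moves any combination
into the cone, as the Riesz extension theorem requires. -/
theorem exists_combAt_bound (e : Comb X) : ∃ b : ℝ, ∀ x, 0 ≤ b + combAt x e := by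
  induction e using Finsupp.induction_linear with
  | zero => exact ⟨0, fun x => by simp⟩
  | add e f he hf =>
    obtain ⟨a, ha⟩ := he
    obtain ⟨b, hb⟩ := hf
    exact ⟨a + b, fun x => by rw [map_add]; linarith [ha x, hb x]⟩
  | single U a =>
    refine ⟨|a|, fun x => ?_⟩
    rw [combVal_single]
    by_cases hx : x ∈ U.1
    · simp only [Set.indicator_of_mem hx, Pi.one_apply]
      linarith [neg_abs_le a]
    · simp [Set.indicator_of_notMem hx]

/-- A set function with the cover bound is attained at each measurable set by a finitely additive
probability measure below it. -/
theorem CoverBound.exists_finAddProb {g : Set X → ℝ} (hg : CoverBound X g)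
    (h0 : ∀ U ∈ X.meas, 0 ≤ g U) (h1 : g Set.univ = 1) {A : Set X} (hA : A ∈ X.meas) :
    ∃ μ : Set X → ℝ, IsFinAddProb X μ ∧ (∀ U ∈ X.meas, μ U ≤ g U) ∧ μ A = g A := by
  classical
  let a : Comb X := Finsupp.single ⟨A, hA⟩ 1
  let e : Comb X := Finsupp.single ⟨_, X.univ_mem_meas⟩ 1
  have hae : ∀ y ∈ Submodule.span ℝ {a, e}, ∃ r s : ℝ, r • a + s • e = y := fun y hy =>
    Submodule.mem_span_pair.1 hy
  have hva : combVal g a = g A := by simp [a, combVal_single]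
  have hve : combVal g e = 1 := by simp [e, combVal_single, h1]
  have hxe : ∀ x, combAt x e = 1 := fun x => by simp [e, combVal_single]
  -- Extend the functional `combVal g` from the span of `A` and the whole space, staying nonnegative
  -- on the cone.
  obtain ⟨L, hL, hpos⟩ := riesz_extension (dominationCone g)
    ⟨Submodule.span ℝ {a, e}, (combVal g).domRestrict _⟩ (by
      rintro ⟨y, hy⟩ ⟨c, hc, h⟩
      obtain ⟨r, s, rfl⟩ := hae y hy
      change 0 ≤ combVal g (r • a + s • e)
      -- If `r • a + s • e` lies in the cone with witness `c`, then `-r 1_A + (g(c) - s) ≤ c`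
      -- pointwise; the cover bound turns this into `r g(A) + s ≥ 0`.
      have := hg.real h0 h1 c hc (a := -r) (t := combVal g c - s) hA (fun x => by
        have := h x
        simp only [map_add, map_smul, smul_eq_mul, hxe] at this
        simp only [a, combVal_single] at this
        linarith)
      simp only [map_add, map_smul, smul_eq_mul, hva, hve]
      linarith) (by
      intro y
      obtain ⟨b, hb⟩ := exists_combAt_bound y
      refine ⟨⟨b • e, Submodule.smul_mem _ _ (Submodule.subset_span (by simp))⟩, ?_⟩
      refine mem_dominationCone_of_nonneg g fun x => ?_
      simp only [map_add, map_smul, smul_eq_mul, hxe, mul_one]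
      exact hb x)
  have hLa : L a = g A := by
    rw [← hva]; exact hL ⟨a, Submodule.subset_span (by simp)⟩
  have hLe : L e = 1 := by
    rw [← hve]; exact hL ⟨e, Submodule.subset_span (by simp)⟩
  -- Both `y` and `-y` lie in the cone, so `L` depends only on the step function; this is what makes
  -- `μ` additive.
  have hzero : ∀ y : Comb X, (∀ x, combAt x y = 0) → L y = 0 := fun y hy => by
    have p1 := hpos y (mem_dominationCone_of_nonneg g fun x => (hy x).ge)
    have p2 := hpos (-y) (mem_dominationCone_of_nonneg g fun x => by rw [map_neg, hy x, neg_zero])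
    rw [map_neg] at p2
    linarith
  let μ : Set X → ℝ := fun U => if h : U ∈ X.meas then L (Finsupp.single ⟨U, h⟩ 1) else 0
  have hμ : ∀ U (h : U ∈ X.meas), μ U = L (Finsupp.single ⟨U, h⟩ 1) := fun U h => dif_pos h
  refine ⟨μ, ⟨?_, ?_, ?_, ?_⟩, ?_, ?_⟩
  · intro U hU
    rw [hμ U hU]
    refine hpos _ (mem_dominationCone_of_nonneg g fun x => ?_)
    rw [combVal_single, one_mul]
    exact Set.indicator_nonneg (fun _ _ => zero_le_one) x
  · rw [hμ _ X.isSetAlgebra.empty_mem]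
    exact hzero _ fun x => by simp [combVal_single]
  · rw [hμ _ X.univ_mem_meas]
    exact hLe
  · intro U hU V hV hd
    rw [hμ U hU, hμ V hV, hμ _ (X.isSetAlgebra.union_mem hU hV), ← map_add, ← sub_eq_zero,
      ← map_sub]
    refine hzero _ fun x => ?_
    simp only [map_sub, map_add, combVal_single, Set.indicator_union_of_disjoint hd, one_mul]
    simp
  · intro U hU
    rw [hμ U hU]
    -- The witness `c = 1_U` puts `g(U) - 1_U` in the cone, so `μ U ≤ g U`.
    have := hpos (g U • e - Finsupp.single ⟨U, hU⟩ 1) ⟨Finsupp.single ⟨U, hU⟩ 1,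
      Finsupp.single_nonneg.2 zero_le_one, fun x => by
        simp only [map_sub, map_smul, hxe, combVal_single, smul_eq_mul]
        linarith⟩
    rw [map_sub, map_smul, hLe, smul_eq_mul] at this
    linarith
  · rw [hμ A hA]
    exact hLa

/-- All additive probabilities below `g` are taken together; the supremum at each measurable set is
then attained. -/
theorem CoverBound.envelope {g : Set X → ℝ} (hg : CoverBound X g)
    (h0 : ∀ U ∈ X.meas, 0 ≤ g U) (h1 : g Set.univ = 1) :
    ∃ P : Set (Set X → ℝ), P.Nonempty ∧ (∀ μ ∈ P, IsFinAddProb X μ) ∧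
      ∀ U ∈ X.meas, IsLUB ((fun μ : Set X → ℝ => μ U) '' P) (g U) := by
  refine ⟨{μ | IsFinAddProb X μ ∧ ∀ U ∈ X.meas, μ U ≤ g U}, ?_, fun μ h => h.1, ?_⟩
  · obtain ⟨μ, hμ, hle, _⟩ := hg.exists_finAddProb h0 h1 X.univ_mem_meas
    exact ⟨μ, hμ, hle⟩
  · intro U hU
    obtain ⟨μ, hμ, hle, he⟩ := hg.exists_finAddProb h0 h1 hU
    refine IsGreatest.isLUB ⟨⟨μ, ⟨hμ, hle⟩, he⟩, ?_⟩
    rintro _ ⟨ν, hν, rfl⟩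
    exact hν.2 U hU

/-! ### Image measures and measurable maps -/

theorem IsFinAddProb.map {Y : Unc.{u}} {f : X → Y} (hf : IsMeasurable f) {μ : Set X → ℝ}
    (hμ : IsFinAddProb X μ) : IsFinAddProb Y fun U => μ (f ⁻¹' U) where
  nonneg U hU := hμ.nonneg _ (hf U hU)
  empty := hμ.empty
  univ := hμ.univ
  union U hU V hV h := hμ.union _ (hf U hU) _ (hf V hV) (h.preimage f)

open Classical in
/-- The image of an upper probability measure under a measurable map. -/
noncomputable def UpperProb.map {Y : Unc.{u}} {f : X → Y} (hf : IsMeasurable f)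
    (g : UpperProb X) : UpperProb Y where
  toFun U := if U ∈ Y.meas then g.toFun (f ⁻¹' U) else 0
  not_meas U hU := if_neg hU
  envelope := by
    obtain ⟨P, ⟨μ, hμ⟩, hP, hlub⟩ := g.envelope
    refine ⟨(fun μ U => μ (f ⁻¹' U)) '' P, ⟨_, μ, hμ, rfl⟩, ?_, fun U hU => ?_⟩
    · rintro _ ⟨ν, hν, rfl⟩
      exact (hP ν hν).map hf
    · rw [if_pos hU, Set.image_image]
      exact hlub _ (hf U hU)

theorem UpperProb.map_apply {Y : Unc.{u}} {f : X → Y} (hf : IsMeasurable f)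
    (g : UpperProb X) {U : Set Y} (hU : U ∈ Y.meas) :
    (g.map hf).toFun U = g.toFun (f ⁻¹' U) := if_pos hU

/-- Measurability can be checked on generators. -/
theorem isMeasurable_generate {α : Type u} {F : Set (Set α)} {f : X → α}
    (h : ∀ U ∈ F, f ⁻¹' U ∈ X.meas) : IsMeasurable (Y := generate α F) f := by
  intro U hU
  induction hU with
  | base U hU => exact h U hU
  | empty => exact X.isSetAlgebra.empty_mem
  | compl U _ ih => exact X.isSetAlgebra.compl_mem ih
  | union U V _ _ ihU ihV => exact X.isSetAlgebra.union_mem ihU ihV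

end Unc

/-! ### Formulas and their interpretations -/

namespace Form

variable {K : Type u} {M : K → Unc.{u}} {T : UPFunctor K} {S : UPFunctor K}

theorem incl_bigAnd {b : Bool} (l : List (Form M T b S)) :
    (bigAnd l).incl = bigAnd (l.map incl) := by
  induction l with
  | nil => rfl
  | cons φ l ih =>
    rw [List.map_cons, bigAnd, bigAnd, ← ih]
    rfl

theorem incl_bigOr {b : Bool} (l : List (Form M T b S)) :
    (bigOr l).incl = bigOr (l.map incl) := by
  induction l with
  | nil => rfl
  | cons φ l ih =>
    rw [List.map_cons, bigOr, bigOr, ← ih]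
    rfl

/-- The index `b` stays variable so that induction on the family applies; hence the heterogeneous
equality. -/
theorem incl_heq_self {b : Bool} (φ : Form M T b S) (hb : b = false) : φ.incl ≍ φ := by
  induction φ <;> subst hb <;> simp_all [incl]

theorem incl_eq_self (φ : Form M T false S) : φ.incl = φ :=
  eq_of_heq (incl_heq_self φ rfl)

/-- Measurable formulas have measurable interpretations. -/
theorem sem_mem_meas {X : Unc.{u}} (α : Coalg M T X) {b : Bool} (φ : Form M T b S)
    (hb : b = true) : sem α φ ∈ (S.obj M X).meas := by
  have generator : ∀ {β : Type u} {F : Set (Set β)} {U : Set β}, U ∈ F →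
      U ∈ (Unc.generate β F).meas := fun h => .base _ h
  induction φ with
  | bot => exact (UPFunctor.obj M X _).isSetAlgebra.empty_mem
  | imp φ ψ ih₁ ih₂ =>
    exact (UPFunctor.obj M X _).isSetAlgebra.union_mem
      ((UPFunctor.obj M X _).isSetAlgebra.compl_mem (ih₁ hb)) (ih₂ hb)
  | const A hA =>
    refine hA.resolve_right fun h => ?_
    simp [hb] at h
  | @pr₁ _ S₁ S₂ φ ih =>
    refine generator ⟨_, ih hb, _, (S₂.obj M X).univ_mem_meas, ?_⟩
    ext z
    simp [sem]
  | @pr₂ _ S₁ S₂ φ ih =>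
    refine generator ⟨_, (S₁.obj M X).univ_mem_meas, _, ih hb, ?_⟩
    ext z
    simp [sem]
  | @in₁ _ S₁ S₂ φ ih =>
    exact ((S₁.obj M X).sum (S₂.obj M X)).isSetAlgebra.union_mem
      (generator (Or.inl ⟨_, ih hb, rfl⟩))
      (generator (Or.inr ⟨_, (S₂.obj M X).univ_mem_meas, Set.image_univ.symm⟩))
  | @in₂ _ S₁ S₂ φ ih =>
    exact ((S₁.obj M X).sum (S₂.obj M X)).isSetAlgebra.union_mem
      (generator (Or.inl ⟨_, (S₁.obj M X).univ_mem_meas, Set.image_univ.symm⟩))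
      (generator (Or.inr ⟨_, ih hb, rfl⟩))
  | next φ ih => exact α.measurable _ (ih hb)
  | box p q φ ih => exact generator ⟨p, q, _, ih rfl, rfl⟩

end Form

/-! ### Derivability and maximal sets -/

namespace DeductionSystem

open Form

variable {K : Type u} {M : K → Unc.{u}} {T : UPFunctor K} {D : DeductionSystem M T}
  {S : UPFunctor K} {hS : S ∈ T.ing}

theorem Derives.mono {Γ Γ' : Set (Form M T false S)} {φ : Form M T false S}
    (h : D.Derives hS Γ φ) (hΓ : Γ ⊆ Γ') : D.Derives hS Γ' φ :=
  D.cut hS _ _ _ (fun ψ hψ => D.assumption hS _ ψ (Or.inl (hΓ hψ))) h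

theorem Derives.of_bot {Γ : Set (Form M T false S)} {φ : Form M T false S}
    (h : D.Derives hS Γ bot) : D.Derives hS Γ φ := by
  refine D.cut hS _ {bot, imp bot φ} _ ?_ (D.modus_ponens hS _ _)
  rintro ψ (rfl | rfl)
  · exact h
  · exact D.assumption hS _ _ (Or.inr (.taut _ fun v hb hv => (hv _ _).2 fun hc => absurd hc hb))

/-- Membership in every maximal extension implies derivability. -/
theorem Lindenbaum.derives (hD : D.Lindenbaum) (hS : S ∈ T.ing) {Γ : Set (Form M T false S)}
    {φ : Form M T false S} (h : ∀ x, D.Maximal hS x → Γ ⊆ x → φ ∈ x) : D.Derives hS Γ φ := by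
  have hbot : D.Derives hS (Γ ∪ {neg φ}) bot := by
    by_contra hc
    obtain ⟨x, hΓ, hx⟩ := hD hS _ hc
    exact (hx.1 φ).1 (h x hx fun ψ hψ => hΓ (Or.inl hψ)) (hΓ (Or.inr rfl))
  refine D.cut hS _ {neg (neg φ), imp (neg (neg φ)) φ} _ ?_ (D.modus_ponens hS _ _)
  rintro ψ (rfl | rfl)
  · exact D.deduction hS _ _ _ hbot
  · refine D.assumption hS _ _ (Or.inr (.taut _ fun v hb hv => ?_))
    simp only [neg, hv]
    tauto

namespace Maximal

variable {x : Set (Form M T false S)}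

theorem mem_of_isAxiom (hx : D.Maximal hS x) {φ : Form M T false S} (h : IsAxiom φ) : φ ∈ x :=
  hx.closed (D.assumption hS _ _ (Or.inr h))

theorem mem_of_derives (hx : D.Maximal hS x) {φ : Form M T false S} (h : D.Derives hS ∅ φ) : φ ∈ x :=
  hx.closed (h.mono (Set.empty_subset _))

theorem bot_notMem (hx : D.Maximal hS x) : bot ∉ x := fun h =>
  hx.2 (D.assumption hS _ _ (Or.inl h))

theorem neg_iff (hx : D.Maximal hS x) (φ : Form M T false S) : neg φ ∈ x ↔ φ ∉ x := by
  have := hx.1 φ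
  tauto

theorem or_iff (hx : D.Maximal hS x) (φ ψ : Form M T false S) :
    Form.or φ ψ ∈ x ↔ φ ∈ x ∨ ψ ∈ x := by
  rw [Form.or, hx.imp_iff, hx.neg_iff]
  tauto

theorem and_iff (hx : D.Maximal hS x) (φ ψ : Form M T false S) :
    Form.and φ ψ ∈ x ↔ φ ∈ x ∧ ψ ∈ x := by
  rw [Form.and, hx.neg_iff, hx.or_iff, hx.neg_iff, hx.neg_iff]
  tauto

theorem iff_iff (hx : D.Maximal hS x) (φ ψ : Form M T false S) :
    Form.iff φ ψ ∈ x ↔ (φ ∈ x ↔ ψ ∈ x) := by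
  rw [Form.iff, hx.and_iff, hx.imp_iff, hx.imp_iff]
  tauto

theorem bigAnd_iff (hx : D.Maximal hS x) (l : List (Form M T false S)) :
    bigAnd l ∈ x ↔ ∀ φ ∈ l, φ ∈ x := by
  induction l with
  | nil => simp [bigAnd, Form.top, hx.neg_iff, hx.bot_notMem]
  | cons φ l ih => simp [bigAnd, hx.and_iff, ih]

theorem bigOr_iff (hx : D.Maximal hS x) (l : List (Form M T false S)) :
    bigOr l ∈ x ↔ ∃ φ ∈ l, φ ∈ x := by
  induction l with
  | nil => simp [bigOr, hx.bot_notMem]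
  | cons φ l ih => simp [bigOr, hx.or_iff, ih]

open Classical in
-- This translates the hypotheses of the cover rules into pointwise inequalities between sums of
-- indicators.
theorem atLeast_iff (hx : D.Maximal hS x) {m k : ℕ} (φ : Fin m → Form M T true S) :
    (atLeast k φ).incl ∈ x ↔ k ≤ (Finset.univ.filter fun i => (φ i).incl ∈ x).card := by
  simp only [atLeast, incl_bigOr, hx.bigOr_iff, List.mem_map, List.mem_sublistsLen]
  constructor
  · rintro ⟨_, ⟨_, ⟨J, ⟨hJ, rfl⟩, rfl⟩, rfl⟩, h⟩
    rw [incl_bigAnd, hx.bigAnd_iff] at h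
    rw [← List.toFinset_card_of_nodup (hJ.nodup (List.nodup_finRange m))]
    refine Finset.card_le_card fun i hi => ?_
    rw [Finset.mem_filter]
    refine ⟨Finset.mem_univ i, h _ ?_⟩
    rw [List.map_map, List.mem_map]
    exact ⟨i, List.mem_toFinset.1 hi, rfl⟩
  · intro h
    -- The first `k` indices whose formulas lie in `x` select a disjunct contained in `x`.
    let J := (List.finRange m).filter fun i => (φ i).incl ∈ x
    have hJ : k ≤ J.length := by
      refine h.trans_eq ?_
      rw [← List.toFinset_card_of_nodup ((List.nodup_finRange m).filter _)]
      congr 1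
      ext i
      simp
    refine ⟨_, ⟨_, ⟨J.take k, ⟨(List.take_sublist k J).trans List.filter_sublist, ?_⟩, rfl⟩,
      rfl⟩, ?_⟩
    · simpa using hJ
    · rw [incl_bigAnd, hx.bigAnd_iff]
      simp only [List.map_map, List.mem_map, forall_exists_index, and_imp]
      rintro _ i hi rfl
      simpa [J] using List.mem_of_mem_take hi

end Maximal

/-- The inverse image of a maximal set under a modality is maximal. -/
theorem Maximal.preimage {S' : UPFunctor K} {hS' : S' ∈ T.ing} {x : Set (Form M T false S)}
    (hx : D.Maximal hS x) {κ : Form M T false S' → Form M T false S}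
    (hbox : ∀ Γ φ, D.Derives hS' Γ φ → D.Derives hS (κ '' Γ) (κ φ))
    (hneg : ∀ φ, IsAxiom (imp (neg (κ φ)) (κ (neg φ)))) (hbot : neg (κ bot) ∈ x) :
    D.Maximal hS' {φ | κ φ ∈ x} := by
  have hbot' := (hx.neg_iff _).1 hbot
  -- The box rule makes the inverse image deductively closed; consistency then reduces to `κ bot ∉
  -- x`.
  have hcl : ∀ Γ φ, D.Derives hS' Γ φ → (∀ ψ ∈ Γ, κ ψ ∈ x) → κ φ ∈ x := fun Γ φ h hΓ =>
    hx.closed ((hbox Γ φ h).mono (by rintro _ ⟨ψ, hψ, rfl⟩; exact hΓ ψ hψ))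
  refine ⟨fun φ => ⟨fun h hn => hbot' ?_, fun h => ?_⟩, fun h => hbot' (hcl _ _ h fun ψ hψ => hψ)⟩
  · refine hcl _ _ (D.modus_ponens hS' φ bot) ?_
    rintro ψ (rfl | rfl)
    · exact h
    · exact hn
  · by_contra hc
    exact h ((hx.imp_iff _ _).1 (hx.mem_of_isAxiom (hneg φ)) ((hx.neg_iff _).2 hc))

theorem ext_neg (φ : Form M T true S) : D.ext hS (neg φ) = (D.ext hS φ)ᶜ := by
  ext x
  exact x.2.neg_iff φ.incl

theorem indicator_ext (φ : Form M T true S) (x : D.canonSpace hS) [Decidable (φ.incl ∈ x.1)] :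
    (D.ext hS φ).indicator (1 : D.canonSpace hS → ℝ) x = if φ.incl ∈ x.1 then 1 else 0 := by
  split_ifs with h
  · exact Set.indicator_of_mem (s := D.ext hS φ) h _
  · exact Set.indicator_of_notMem (s := D.ext hS φ) h _

/-! ### The canonical upper probability measure -/

section Measure

variable {h : .delta S ∈ T.ing}

/-- The value of the canonical measure of `x` at `|φ|`. -/
noncomputable def canonVal (x : D.canonSpace h) (φ : Form M T true S) : ℝ :=
  sSup {t : ℝ | ∃ q : unitInterval, t = q ∧ upperGE q φ ∈ x.1}

/-- For `p = 0` the archimedean rule has no premises. -/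
theorem upperGE_zero_mem (x : D.canonSpace h) (φ : Form M T true S) : upperGE 0 φ ∈ x.1 :=
  x.2.closed ((D.archimedean_upper h φ 0).mono (by
    rintro _ ⟨q, hq, _⟩
    exact absurd hq (not_lt.2 unitInterval.nonneg')))

theorem upperGE_anti (x : D.canonSpace h) {φ : Form M T true S} {p q : unitInterval}
    (hqp : q ≤ p) (hp : upperGE p φ ∈ x.1) : upperGE q φ ∈ x.1 := by
  rcases hqp.eq_or_lt with rfl | hlt
  · exact hp
  by_contra hq
  have h1 := (x.2.imp_iff _ _).1 (x.2.mem_of_isAxiom (.upper_lt_le φ q)) ((x.2.neg_iff _).2 hq)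
  have h2 := (x.2.imp_iff _ _).1 (x.2.mem_of_isAxiom (.upper_le_lt φ q p hlt)) h1
  exact (x.2.neg_iff _).1 h2 hp

theorem canonVal_bddAbove (x : D.canonSpace h) (φ : Form M T true S) :
    BddAbove {t : ℝ | ∃ q : unitInterval, t = q ∧ upperGE q φ ∈ x.1} := by
  refine ⟨1, ?_⟩
  rintro _ ⟨q, rfl, _⟩
  exact q.2.2

theorem canonVal_nonneg (x : D.canonSpace h) (φ : Form M T true S) : 0 ≤ canonVal x φ :=
  le_csSup (canonVal_bddAbove x φ) ⟨0, rfl, upperGE_zero_mem x φ⟩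

theorem canonVal_le_one (x : D.canonSpace h) (φ : Form M T true S) : canonVal x φ ≤ 1 := by
  refine csSup_le ⟨0, 0, rfl, upperGE_zero_mem x φ⟩ ?_
  rintro _ ⟨q, rfl, _⟩
  exact q.2.2

/-- The archimedean rule says that the supremum is attained. -/
theorem upperGE_mem_iff (x : D.canonSpace h) (φ : Form M T true S) (p : unitInterval) :
    upperGE p φ ∈ x.1 ↔ (p : ℝ) ≤ canonVal x φ := by
  constructor
  · exact fun hp => le_csSup (canonVal_bddAbove x φ) ⟨p, rfl, hp⟩
  · intro hp
    refine x.2.closed ((D.archimedean_upper h φ p).mono ?_)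
    rintro _ ⟨q, hq, rfl⟩
    have hlt : (q : ℝ) < canonVal x φ := lt_of_lt_of_le hq hp
    obtain ⟨_, ⟨r, rfl, hr⟩, hqr⟩ := exists_lt_of_lt_csSup
      (by exact ⟨0, 0, rfl, upperGE_zero_mem x φ⟩) hlt
    exact upperGE_anti x (le_of_lt (show q < r from hqr)) hr

theorem upperLE_mem_iff (x : D.canonSpace h) (φ : Form M T true S) (p : unitInterval) :
    upperLE p φ ∈ x.1 ↔ canonVal x φ ≤ (p : ℝ) := by
  have hlt : ∀ r : unitInterval, canonVal x φ < r → upperLE r φ ∈ x.1 := fun r hr =>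
    (x.2.imp_iff _ _).1 (x.2.mem_of_isAxiom (.upper_lt_le φ r))
      ((x.2.neg_iff _).2 fun hc => not_le.2 hr ((upperGE_mem_iff x φ r).1 hc))
  constructor
  · intro hp
    by_contra! hc
    -- At `q` equal to the value itself, `upperGE q φ` lies in `x`, while `p < q` and `upperLE p φ`
    -- exclude it.
    let q : unitInterval := ⟨canonVal x φ, canonVal_nonneg x φ, canonVal_le_one x φ⟩
    have h2 := (x.2.imp_iff _ _).1 (x.2.mem_of_isAxiom (.upper_le_lt φ p q hc)) hp
    exact (x.2.neg_iff _).1 h2 ((upperGE_mem_iff x φ q).2 le_rfl)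
  · intro hp
    -- By definition `upperLE p φ` is `lowerGE (1 - p) (neg φ)`, so the lower archimedean rule
    -- reduces the claim to bounds strictly above the value.
    refine x.2.closed ((D.archimedean_lower h (neg φ) (unitInterval.symm p)).mono ?_)
    rintro _ ⟨q, hq, rfl⟩
    have := hlt (unitInterval.symm q) (lt_of_le_of_lt hp (by
      have hq' : (q : ℝ) < 1 - p := hq
      change (p : ℝ) < 1 - q
      linarith))
    rwa [upperLE, unitInterval.symm_symm] at this

theorem lowerGE_mem_iff (x : D.canonSpace h) (φ : Form M T true S) (q : unitInterval) :
    lowerGE q φ ∈ x.1 ↔ (q : ℝ) ≤ 1 - canonVal x (neg φ) := by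
  rw [(x.2.iff_iff _ _).1 (x.2.mem_of_isAxiom (.lower_dual φ q)), upperLE_mem_iff,
    unitInterval.coe_symm_eq]
  constructor <;> intro _ <;> linarith

theorem box_mem_iff (x : D.canonSpace h) (φ : Form M T true S) (p q : unitInterval) :
    box p q φ ∈ x.1 ↔ (p : ℝ) ≤ canonVal x φ ∧ (q : ℝ) ≤ 1 - canonVal x (neg φ) := by
  rw [(x.2.iff_iff _ _).1 (x.2.mem_of_isAxiom (.box_iff φ p q)), x.2.and_iff, upperGE_mem_iff,
    lowerGE_mem_iff]

/-- A covering valid at all maximal sets is derivable by Lindenbaum, so the cover rules apply, with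
the values `canonVal x (φs i)` themselves as the bounds `p_i`. -/
theorem canonVal_cover (hD : D.Lindenbaum) (x : D.canonSpace h) {m : ℕ} (n k : ℕ)
    (φ : Form M T true S)
    (φs : Fin m → Form M T true S)
    (hc : ∀ y : D.canonSpace (UPFunctor.delta_arg h),
      (n : ℝ) * (D.ext _ φ).indicator 1 y + k ≤ ∑ i,
        (D.ext _ (φs i)).indicator (1 : D.canonSpace (UPFunctor.delta_arg h) → ℝ) y) :
    (n : ℝ) * canonVal x φ + k ≤ ∑ i, canonVal x (φs i) := by
  classical
  have hc' : ∀ y : D.canonSpace (UPFunctor.delta_arg h),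
      (if φ.incl ∈ y.1 then n else 0) + k ≤
        (Finset.univ.filter fun i => (φs i).incl ∈ y.1).card := fun y => by
    have := hc y
    simp only [indicator_ext] at this
    rw [Finset.sum_boole] at this
    rw [← Nat.cast_le (α := ℝ)]
    refine le_trans (le_of_eq ?_) this
    push_cast
    split_ifs <;> simp
  let ps : Fin m → unitInterval := fun i =>
    ⟨canonVal x (φs i), canonVal_nonneg x _, canonVal_le_one x _⟩
  have hps : bigAnd (List.ofFn fun i => upperLE (ps i) (φs i)) ∈ x.1 := by
    rw [x.2.bigAnd_iff]
    intro ψ hψ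
    obtain ⟨i, rfl⟩ := (List.mem_ofFn' _ _).1 hψ
    exact (upperLE_mem_iff x (φs i) (ps i)).2 le_rfl
  have hk : D.Derives (UPFunctor.delta_arg h) ∅ (atLeast k φs).incl :=
    hD.derives _ fun y hy _ => (hy.atLeast_iff φs).2
      (le_trans (Nat.le_add_left _ _) (hc' ⟨y, hy⟩))
  -- The second cover rule gives `k ≤ ∑ p_i`. This settles `n = 0` and makes the truncation at `0`
  -- in the first rule harmless.
  have hsum : (k : ℝ) ≤ ∑ i, canonVal x (φs i) := by
    by_contra! hlt
    exact (x.2.neg_iff _).1 (x.2.mem_of_derives (D.cover₂ h m k φs ps hk hlt)) hps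
  rcases Nat.eq_zero_or_pos n with rfl | hn
  · simpa using hsum
  have hn' : (0 : ℝ) < n := Nat.cast_pos.2 hn
  let p : unitInterval := ⟨max 0 (min 1 (((∑ i, (ps i : ℝ)) - k) / n)),
    le_max_left _ _, max_le zero_le_one (min_le_left _ _)⟩
  have hnk : D.Derives (UPFunctor.delta_arg h) ∅ (imp φ (atLeast (n + k) φs)).incl :=
    hD.derives _ fun y hy _ => (hy.imp_iff _ _).2 fun hφ => (hy.atLeast_iff φs).2 (by
      have := hc' ⟨y, hy⟩
      rwa [if_pos hφ] at this)
  have hle := (upperLE_mem_iff x φ p).1 ((x.2.imp_iff _ _).1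
    (x.2.mem_of_derives (D.cover₁ h m n k φ φs ps p hn hnk hk rfl)) hps)
  have hle' : canonVal x φ ≤ ((∑ i, canonVal x (φs i)) - k) / n := by
    refine hle.trans (max_le ?_ (min_le_right _ _))
    exact div_nonneg (sub_nonneg.2 hsum) hn'.le
  rw [le_div_iff₀ hn'] at hle'
  linarith

/-- Covering one set by the other (`n = 1`, `k = 0`) in both directions shows that the value depends
only on `|φ|`, so `g_x` is well defined. -/
theorem canonVal_congr (hD : D.Lindenbaum) (x : D.canonSpace h) {φ ψ : Form M T true S}
    (he : D.ext (UPFunctor.delta_arg h) φ = D.ext _ ψ) : canonVal x φ = canonVal x ψ := by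
  have key : ∀ {φ ψ : Form M T true S}, D.ext (UPFunctor.delta_arg h) φ = D.ext _ ψ →
      canonVal x φ ≤ canonVal x ψ := fun {φ ψ} he => by
    simpa using canonVal_cover hD x 1 0 φ (fun _ : Fin 1 => ψ) (by simp [he])
  exact le_antisymm (key he) (key he.symm)

open Classical in
/-- The canonical measure as a set function. -/
noncomputable def canonFun (x : D.canonSpace h) (B : Set (D.canonSpace (UPFunctor.delta_arg h))) :
    ℝ :=
  if hB : ∃ φ, B = D.ext _ φ then canonVal x hB.choose else 0

theorem canonFun_ext (hD : D.Lindenbaum) (x : D.canonSpace h) (φ : Form M T true S) :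
    canonFun x (D.ext _ φ) = canonVal x φ := by
  have hB : ∃ ψ, D.ext (UPFunctor.delta_arg h) φ = D.ext _ ψ := ⟨φ, rfl⟩
  rw [canonFun, dif_pos hB]
  exact canonVal_congr hD x hB.choose_spec.symm

theorem canonFun_coverBound (hD : D.Lindenbaum) (x : D.canonSpace h) :
    Unc.CoverBound (D.canonSpace (UPFunctor.delta_arg h)) (canonFun x) := by
  rintro m n k _ As ⟨φ, rfl⟩ hAs hc
  choose φs hφs using hAs
  obtain rfl : As = fun i => D.ext _ (φs i) := funext hφs
  change (n : ℝ) * canonFun x (D.ext _ φ) + k ≤ ∑ i, canonFun x (D.ext _ (φs i))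
  simp only [canonFun_ext hD]
  exact canonVal_cover hD x n k φ φs hc

theorem canonFun_univ (hD : D.Lindenbaum) (x : D.canonSpace h) : canonFun x Set.univ = 1 := by
  have e : (Set.univ : Set (D.canonSpace (UPFunctor.delta_arg h))) = D.ext _ Form.top := by
    ext y
    exact iff_of_true trivial ((y.2.neg_iff _).2 y.2.bot_notMem)
  rw [e, canonFun_ext hD]
  refine le_antisymm (canonVal_le_one x _) ?_
  simpa using canonVal_cover hD x 0 1 bot (fun _ : Fin 1 => Form.top) (by simp [← e])

/-- The canonical measure `g_x`. -/
noncomputable def canonMeasure (hD : D.Lindenbaum) (x : D.canonSpace h) :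
    Unc.UpperProb (D.canonSpace (UPFunctor.delta_arg h)) where
  toFun := canonFun x
  not_meas U hU := dif_neg hU
  envelope := (canonFun_coverBound hD x).envelope (by
    rintro _ ⟨φ, rfl⟩
    exact (canonVal_nonneg x φ).trans_eq (canonFun_ext hD x φ).symm) (canonFun_univ hD x)

theorem isCanonMeasure_canonMeasure (hD : D.Lindenbaum) (x : D.canonSpace h) :
    D.IsCanonMeasure h x (canonMeasure hD x) :=
  canonFun_ext hD x

end Measure

end DeductionSystem

/-! ### The maps `r_S` and the truth lemma -/

namespace DeductionSystem

open Form

variable {K : Type u} {M : K → Unc.{u}} {T : UPFunctor K} {D : DeductionSystem M T}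
  {S S₁ S₂ : UPFunctor K}

theorem Maximal.pr₁ {h : .prod S₁ S₂ ∈ T.ing} {x : Set (Form M T false (.prod S₁ S₂))}
    (hx : D.Maximal h x) : D.Maximal (UPFunctor.prod_left h) {φ | Form.pr₁ φ ∈ x} :=
  hx.preimage (D.box_pr₁ h) .pr₁_neg (hx.mem_of_isAxiom .pr₁_bot)

theorem Maximal.pr₂ {h : .prod S₁ S₂ ∈ T.ing} {x : Set (Form M T false (.prod S₁ S₂))}
    (hx : D.Maximal h x) : D.Maximal (UPFunctor.prod_right h) {φ | Form.pr₂ φ ∈ x} :=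
  hx.preimage (D.box_pr₂ h) .pr₂_neg (hx.mem_of_isAxiom .pr₂_bot)

theorem Maximal.in₁ {h : .sum S₁ S₂ ∈ T.ing} {x : Set (Form M T false (.sum S₁ S₂))}
    (hx : D.Maximal h x) (hb : neg (Form.in₁ bot) ∈ x) :
    D.Maximal (UPFunctor.sum_left h) {φ | Form.in₁ φ ∈ x} :=
  hx.preimage (D.box_in₁ h) .in₁_neg hb

theorem Maximal.in₂ {h : .sum S₁ S₂ ∈ T.ing} {x : Set (Form M T false (.sum S₁ S₂))}
    (hx : D.Maximal h x) (hb : neg (Form.in₂ bot) ∈ x) :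
    D.Maximal (UPFunctor.sum_right h) {φ | Form.in₂ φ ∈ x} :=
  hx.preimage (D.box_in₂ h) .in₂_neg hb

theorem Maximal.next {x : Set (Form M T false .id)} (hx : D.Maximal T.id_mem_ing x) :
    D.Maximal T.self_mem_ing {φ | Form.next φ ∈ x} :=
  hx.preimage D.box_next .next_neg (hx.mem_of_isAxiom .next_bot)

/-- Exactly one of the two summands is the relevant one. -/
theorem Maximal.neg_in₂_bot_iff {h : .sum S₁ S₂ ∈ T.ing} {x : Set (Form M T false (.sum S₁ S₂))}
    (hx : D.Maximal h x) : neg (Form.in₂ bot) ∈ x ↔ neg (Form.in₁ bot) ∉ x := by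
  rw [hx.neg_iff, (hx.iff_iff _ _).1 (hx.mem_of_isAxiom .in_bot)]

theorem Maximal.exists_single {k : K} {h : .const k ∈ T.ing} {x : Set (Form M T false (.const k))}
    (hx : D.Maximal h x) : ∃ c : M k, single c ∈ x := by
  by_contra! hc
  refine hx.2 ((D.constant h).mono ?_)
  rintro _ ⟨c, rfl⟩
  exact (hx.neg_iff _).2 (hc c)

theorem Maximal.const_iff {k : K} {h : .const k ∈ T.ing} {x : Set (Form M T false (.const k))}
    (hx : D.Maximal h x) {c : M k} (hc : single c ∈ x) (A : Set (M k)) (hA) :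
    Form.const A hA ∈ x ↔ c ∈ A := by
  constructor
  · intro hAx
    by_contra hcA
    exact (hx.neg_iff _).1
      ((hx.imp_iff _ _).1 (hx.mem_of_isAxiom (.const_not_mem A hA c hcA)) hc) hAx
  · intro hcA
    exact (hx.imp_iff _ _).1 (hx.mem_of_isAxiom (.const_mem A hA c hcA)) hc

/-- Measurability of a set of maximal sets is proved by naming a formula that defines it. -/
theorem canonSpace_mem_meas {hS : S ∈ T.ing} (φ : Form M T true S)
    {B : Set (D.canonSpace hS)} (h : ∀ x : D.canonSpace hS, x ∈ B ↔ φ.incl ∈ x.1) :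
    B ∈ (D.canonSpace hS).meas :=
  ⟨φ, Set.ext h⟩

/-- The map into a constant space that sends `x` to the point `c` with `{c} ∈ x`. -/
noncomputable def canonConst {k : K} (h : .const k ∈ T.ing) (x : D.canonSpace h) : M k :=
  x.2.exists_single.choose

theorem single_canonConst_mem {k : K} (h : .const k ∈ T.ing) (x : D.canonSpace h) :
    single (canonConst h x) ∈ x.1 :=
  x.2.exists_single.choose_spec

theorem canonConst_measurable {k : K} (h : .const k ∈ T.ing) :
    Unc.IsMeasurable (X := D.canonSpace h) (canonConst (D := D) h) := by
  intro A hA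
  exact canonSpace_mem_meas (.const A (Or.inl hA)) fun x =>
    (x.2.const_iff (single_canonConst_mem h x) A _).symm

section Maps

variable {Y Z : Unc.{u}}

/-- The map into a product given by maps on the factors. -/
def canonProd (h : .prod S₁ S₂ ∈ T.ing) (f : D.canonSpace (UPFunctor.prod_left h) → Y)
    (g : D.canonSpace (UPFunctor.prod_right h) → Z) (x : D.canonSpace h) : Y.prod Z :=
  (f ⟨_, x.2.pr₁⟩, g ⟨_, x.2.pr₂⟩)

theorem canonProd_measurable (h : .prod S₁ S₂ ∈ T.ing)
    {f : D.canonSpace (UPFunctor.prod_left h) → Y}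
    {g : D.canonSpace (UPFunctor.prod_right h) → Z} (hf : Unc.IsMeasurable f)
    (hg : Unc.IsMeasurable g) : Unc.IsMeasurable (canonProd h f g) := by
  refine Unc.isMeasurable_generate ?_
  rintro _ ⟨U, hU, V, hV, rfl⟩
  obtain ⟨φ, hφ⟩ := hf U hU
  obtain ⟨ψ, hψ⟩ := hg V hV
  refine canonSpace_mem_meas (.and (.pr₁ φ) (.pr₂ ψ)) fun x => ?_
  refine Iff.trans ?_ (x.2.and_iff (.pr₁ φ.incl) (.pr₂ ψ.incl)).symm
  exact and_congr (Set.ext_iff.1 hφ ⟨_, x.2.pr₁⟩) (Set.ext_iff.1 hψ ⟨_, x.2.pr₂⟩)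

open Classical in
/-- The map into a sum given by maps on the summands. -/
noncomputable def canonSum (h : .sum S₁ S₂ ∈ T.ing)
    (f : D.canonSpace (UPFunctor.sum_left h) → Y)
    (g : D.canonSpace (UPFunctor.sum_right h) → Z) (x : D.canonSpace h) : Y.sum Z :=
  if hb : neg (Form.in₁ bot) ∈ x.1 then .inl (f ⟨_, x.2.in₁ hb⟩)
  else .inr (g ⟨_, x.2.in₂ (x.2.neg_in₂_bot_iff.2 hb)⟩)

theorem canonSum_measurable (h : .sum S₁ S₂ ∈ T.ing)
    {f : D.canonSpace (UPFunctor.sum_left h) → Y}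
    {g : D.canonSpace (UPFunctor.sum_right h) → Z} (hf : Unc.IsMeasurable f)
    (hg : Unc.IsMeasurable g) : Unc.IsMeasurable (canonSum h f g) := by
  refine Unc.isMeasurable_generate ?_
  rintro _ (⟨U, hU, rfl⟩ | ⟨V, hV, rfl⟩)
  · obtain ⟨φ, hφ⟩ := hf U hU
    -- The conjunct `¬ [in₁] ⊥` is needed because `[in₁] φ` also holds throughout the other summand.
    refine canonSpace_mem_meas (.and (.neg (.in₁ .bot)) (.in₁ φ)) fun x => ?_
    refine Iff.trans ?_ (x.2.and_iff (.neg (.in₁ .bot)) (.in₁ φ.incl)).symm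
    rw [Set.mem_preimage, canonSum]
    split_ifs with hb
    · have key : f ⟨_, x.2.in₁ hb⟩ ∈ U ↔ Form.in₁ φ.incl ∈ x.1 := Set.ext_iff.1 hφ _
      simpa [hb] using key
    · simp [hb]
  · obtain ⟨ψ, hψ⟩ := hg V hV
    refine canonSpace_mem_meas (.and (.neg (.in₂ .bot)) (.in₂ ψ)) fun x => ?_
    refine Iff.trans ?_ (x.2.and_iff (.neg (.in₂ .bot)) (.in₂ ψ.incl)).symm
    rw [Set.mem_preimage, canonSum]
    have hn := x.2.neg_in₂_bot_iff
    split_ifs with hb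
    · simp [hn, hb]
    · have key : g ⟨_, x.2.in₂ (hn.2 hb)⟩ ∈ V ↔ Form.in₂ ψ.incl ∈ x.1 := Set.ext_iff.1 hψ _
      simpa [hn, hb] using key

/-- This serves both the measurability of `r` at `Δ* S` and the modal step of the truth lemma. -/
theorem mem_beta_map_iff {h : .delta S ∈ T.ing} {x : D.canonSpace h}
    {g : Unc.UpperProb (D.canonSpace (UPFunctor.delta_arg h))} (hg : D.IsCanonMeasure h x g)
    {f : D.canonSpace (UPFunctor.delta_arg h) → Y} {g' : Unc.UpperProb Y}
    (hg' : ∀ A ∈ Y.meas, g'.toFun A = g.toFun (f ⁻¹' A)) {U : Set Y} (hU : U ∈ Y.meas)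
    {φ : Form M T true S} (hφ : f ⁻¹' U = D.ext _ φ) (p q : unitInterval) :
    g' ∈ Unc.beta Y p q U ↔ box p q φ ∈ x.1 := by
  rw [box_mem_iff, Unc.beta, Set.mem_ofPred_eq, hg' U hU, hg' _ (Y.isSetAlgebra.compl_mem hU),
    Set.preimage_compl, hφ, ← ext_neg, hg, hg]
  rfl

theorem canonMeasure_map_measurable (hD : D.Lindenbaum) (h : .delta S ∈ T.ing)
    {f : D.canonSpace (UPFunctor.delta_arg h) → Y} (hf : Unc.IsMeasurable f) :
    Unc.IsMeasurable (X := D.canonSpace h) (Y := Y.delta)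
      fun x => (canonMeasure hD x).map hf := by
  refine Unc.isMeasurable_generate ?_
  rintro _ ⟨p, q, U, hU, rfl⟩
  obtain ⟨φ, hφ⟩ := hf U hU
  exact canonSpace_mem_meas (.box p q φ) fun x =>
    mem_beta_map_iff (isCanonMeasure_canonMeasure hD x)
      (fun A hA => Unc.UpperProb.map_apply hf _ hA) hU hφ p q

end Maps

/-- The maps `r_S` together with their measurability. -/
noncomputable def canonMapAux (hD : D.Lindenbaum) : (S : UPFunctor K) → (hS : S ∈ T.ing) →
    {f : D.canonSpace hS → S.obj M D.canonId // Unc.IsMeasurable f}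
  | .id, _ => ⟨fun x => x, fun _ hU => hU⟩
  | .const _, h => ⟨canonConst h, canonConst_measurable h⟩
  | .prod S₁ S₂, h =>
    let f := canonMapAux hD S₁ (UPFunctor.prod_left h)
    let g := canonMapAux hD S₂ (UPFunctor.prod_right h)
    ⟨canonProd h f.1 g.1, canonProd_measurable h f.2 g.2⟩
  | .sum S₁ S₂, h =>
    let f := canonMapAux hD S₁ (UPFunctor.sum_left h)
    let g := canonMapAux hD S₂ (UPFunctor.sum_right h)
    ⟨canonSum h f.1 g.1, canonSum_measurable h f.2 g.2⟩
  | .delta S, h =>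
    -- Pushing `g_x` forward requires measurability of the map at `S`, so the recursion carries it
    -- along.
    let f := canonMapAux hD S (UPFunctor.delta_arg h)
    ⟨fun x => (canonMeasure hD x).map f.2, canonMeasure_map_measurable hD h f.2⟩

/-- The map `r_S`. -/
noncomputable def canonMap (hD : D.Lindenbaum) {S : UPFunctor K} (hS : S ∈ T.ing) :
    D.canonSpace hS → S.obj M D.canonId :=
  (canonMapAux hD S hS).1

theorem isCanonMap_canonMap (hD : D.Lindenbaum) :
    D.IsCanonMap fun {_} hS => canonMap (D := D) hD hS where
  measurable {S} hS := (canonMapAux hD S hS).2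
  id _ := rfl
  const h x := single_canonConst_mem h x
  prod h x := ⟨⟨_, x.2.pr₁⟩, ⟨_, x.2.pr₂⟩, rfl, rfl, rfl⟩
  sum h x := by
    have hn := x.2.neg_in₂_bot_iff
    by_cases hb : neg (Form.in₁ bot) ∈ x.1
    · exact Or.inl ⟨hb, fun hc => hn.1 hc hb, ⟨_, x.2.in₁ hb⟩, rfl, dif_pos hb⟩
    · exact Or.inr ⟨hn.2 hb, hb, ⟨_, x.2.in₂ (hn.2 hb)⟩, rfl, dif_neg hb⟩
  delta {S} h x := ⟨canonMeasure hD x, isCanonMeasure_canonMeasure hD x, fun _ hA =>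
    Unc.UpperProb.map_apply (canonMapAux hD S (UPFunctor.delta_arg h)).2 _ hA⟩

/-- The recursive clauses determine the maps `r_S`. -/
theorem IsCanonMap.unique
    {r r' : ∀ {S : UPFunctor K} (hS : S ∈ T.ing), D.canonSpace hS → S.obj M D.canonId}
    (hr : D.IsCanonMap r) (hr' : D.IsCanonMap r') (S : UPFunctor K) (hS : S ∈ T.ing) :
    r hS = r' hS := by
  induction S with
  | id => exact funext fun x => (hr.id x).trans (hr'.id x).symm
  | const k =>
    funext x
    -- Apply `const_iff` to the singleton of the second value: the first value must belong to it.
    exact (x.2.const_iff (hr.const hS x) _ _).1 (hr'.const hS x)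
  | prod S₁ S₂ ih₁ ih₂ =>
    funext x
    obtain ⟨y₁, y₂, h₁, h₂, e⟩ := hr.prod hS x
    obtain ⟨y₁', y₂', h₁', h₂', e'⟩ := hr'.prod hS x
    obtain rfl : y₁ = y₁' := Subtype.ext (h₁.trans h₁'.symm)
    obtain rfl : y₂ = y₂' := Subtype.ext (h₂.trans h₂'.symm)
    rw [e, e', ih₁, ih₂]
  | sum S₁ S₂ ih₁ ih₂ =>
    funext x
    rcases hr.sum hS x with ⟨hb, hb', y, hy, e⟩ | ⟨hb, hb', y, hy, e⟩ <;>
    rcases hr'.sum hS x with ⟨hc, hc', z, hz, e'⟩ | ⟨hc, hc', z, hz, e'⟩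
    · obtain rfl : y = z := Subtype.ext (hy.trans hz.symm)
      rw [e, e', ih₁]
    · exact absurd hb hc'
    · exact absurd hb hc'
    · obtain rfl : y = z := Subtype.ext (hy.trans hz.symm)
      rw [e, e', ih₂]
  | delta S ih =>
    funext x
    obtain ⟨g, hg, e⟩ := hr.delta hS x
    obtain ⟨g', hg', e'⟩ := hr'.delta hS x
    refine Unc.UpperProb.ext (funext fun A => ?_)
    by_cases hA : A ∈ (S.obj M D.canonId).meas
    · rw [e A hA, e' A hA, ih]
      -- The canonical measure is prescribed only on sets `|φ|`; measurability puts the preimage in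
      -- that form.
      obtain ⟨φ, hφ⟩ := hr'.measurable (UPFunctor.delta_arg hS) A hA
      rw [hφ]
      exact (hg φ).trans (hg' φ).symm
    · rw [Unc.UpperProb.not_meas _ A hA, Unc.UpperProb.not_meas _ A hA]

/-- The truth lemma. -/
theorem IsCanonMap.mem_sem_iff
    {r : ∀ {S : UPFunctor K} (hS : S ∈ T.ing), D.canonSpace hS → S.obj M D.canonId}
    (hr : D.IsCanonMap r) {α : Coalg M T D.canonId}
    (hα : ∀ x : D.canonId, ∃ y : D.canonSpace T.self_mem_ing,
      y.1 = {φ | next φ ∈ x.1} ∧ α.toFun x = r T.self_mem_ing y)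
    {b : Bool} (φ : Form M T b S) (hS : S ∈ T.ing) (x : D.canonSpace hS) :
    r hS x ∈ sem α φ ↔ φ.incl ∈ x.1 := by
  induction φ with
  | bot => exact iff_of_false (fun h => h) x.2.bot_notMem
  | imp φ ψ ih₁ ih₂ =>
    refine Iff.trans ?_ (x.2.imp_iff φ.incl ψ.incl).symm
    rw [← ih₁, ← ih₂]
    exact imp_iff_not_or.symm
  | const A hA => exact (x.2.const_iff (hr.const hS x) A _).symm
  | pr₁ φ ih =>
    obtain ⟨y₁, y₂, h₁, h₂, e⟩ := hr.prod hS x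
    rw [e]
    refine (ih _ y₁).trans ?_
    rw [h₁]
    rfl
  | pr₂ φ ih =>
    obtain ⟨y₁, y₂, h₁, h₂, e⟩ := hr.prod hS x
    rw [e]
    refine (ih _ y₂).trans ?_
    rw [h₂]
    rfl
  | in₁ φ ih =>
    rcases hr.sum hS x with ⟨hb, hb', y, hy, e⟩ | ⟨hb, hb', y, hy, e⟩
    · rw [e]
      refine Iff.trans ?_ ((ih _ y).trans ?_)
      · simp [sem]
      · rw [hy]
        rfl
    · rw [e]
      -- In the other summand `[in₁] ⊥` belongs to `x`, and boxing `⊥ ⊢ φ` gives `[in₁] φ`.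
      refine iff_of_true (by simp [sem]) (x.2.closed ((D.box_in₁ hS {bot} _ ?_).mono ?_))
      · exact Derives.of_bot (D.assumption _ _ _ (Or.inl rfl))
      · rintro _ ⟨_, rfl, rfl⟩
        exact not_not.1 (mt (x.2.neg_iff _).2 hb')
  | in₂ φ ih =>
    rcases hr.sum hS x with ⟨hb, hb', y, hy, e⟩ | ⟨hb, hb', y, hy, e⟩
    · rw [e]
      refine iff_of_true (by simp [sem]) (x.2.closed ((D.box_in₂ hS {bot} _ ?_).mono ?_))
      · exact Derives.of_bot (D.assumption _ _ _ (Or.inl rfl))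
      · rintro _ ⟨_, rfl, rfl⟩
        exact not_not.1 (mt (x.2.neg_iff _).2 hb')
    · rw [e]
      refine Iff.trans ?_ ((ih _ y).trans ?_)
      · simp [sem]
      · rw [hy]
        rfl
  | next φ ih =>
    obtain ⟨y, hy, e⟩ := hα x
    have hx : r hS x = x := hr.id x
    rw [hx, sem, Set.mem_preimage, e]
    refine (ih _ y).trans ?_
    rw [hy]
    rfl
  | box p q φ ih =>
    obtain ⟨g, hg, e⟩ := hr.delta hS x
    -- The induction hypothesis says that the preimage of the interpretation of `φ` under `r` is
    -- `|φ|`.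
    exact mem_beta_map_iff hg e (sem_mem_meas α φ rfl) (Set.ext fun y => ih _ y) p q

/-! ### The canonical coalgebra and completeness -/

theorem IsCanonCoalg.unique {α α' : Coalg M T D.canonId} (hα : D.IsCanonCoalg α)
    (hα' : D.IsCanonCoalg α') : α = α' := by
  obtain ⟨r, hr, h⟩ := hα
  obtain ⟨r', hr', h'⟩ := hα'
  refine Coalg.ext (funext fun x => ?_)
  obtain ⟨y, hy, e⟩ := h x
  obtain ⟨y', hy', e'⟩ := h' x
  obtain rfl : y = y' := Subtype.ext (hy.trans hy'.symm)
  rw [e, e', hr.unique hr']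

/-- The canonical coalgebra. -/
noncomputable def canonCoalg (hD : D.Lindenbaum) : Coalg M T D.canonId where
  toFun x := canonMap hD T.self_mem_ing ⟨_, x.2.next⟩
  measurable U hU := by
    obtain ⟨φ, hφ⟩ := (canonMapAux hD T T.self_mem_ing).2 U hU
    exact canonSpace_mem_meas (.next φ) fun x => Set.ext_iff.1 hφ ⟨_, x.2.next⟩

theorem isCanonCoalg_canonCoalg (hD : D.Lindenbaum) : D.IsCanonCoalg (canonCoalg hD) :=
  ⟨fun {_} hS => canonMap hD hS, isCanonMap_canonMap hD, fun x => ⟨⟨_, x.2.next⟩, rfl, rfl⟩⟩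

theorem IsCanonCoalg.derives {α : Coalg M T D.canonId} (hα : D.IsCanonCoalg α)
    (hD : D.Lindenbaum) (hS : S ∈ T.ing) {Γ : Set (Form M T false S)} {φ : Form M T false S}
    (h : Entails α Γ φ) : D.Derives hS Γ φ := by
  obtain ⟨r, hr, hα⟩ := hα
  refine hD.derives hS fun x hx hΓ => ?_
  have truth : ∀ ψ : Form M T false S, r hS ⟨x, hx⟩ ∈ sem α ψ ↔ ψ ∈ x := fun ψ => by
    simpa only [incl_eq_self] using hr.mem_sem_iff hα ψ hS ⟨x, hx⟩
  exact (truth φ).1 (h _ fun ψ hψ => (truth ψ).2 (hΓ hψ))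

/-- Since `r_Id` is the identity, every point at this sort is itself a maximal set, hence
deductively closed. At other sorts the truth lemma reaches only points in the range of `r_S`. -/
theorem IsCanonCoalg.entails_id {α : Coalg M T D.canonId} (hα : D.IsCanonCoalg α)
    {Γ : Set (Form M T false .id)} {φ : Form M T false .id} (h : D.Derives T.id_mem_ing Γ φ) :
    Entails α Γ φ := by
  obtain ⟨r, hr, hα⟩ := hα
  intro (y : D.canonId) hy
  have truth : ∀ ψ : Form M T false .id, y ∈ sem α ψ ↔ ψ ∈ y.1 := fun ψ => by
    have := hr.mem_sem_iff hα ψ T.id_mem_ing y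
    rwa [hr.id, incl_eq_self] at this
  exact (truth φ).2 (y.2.closed (h.mono fun ψ hψ => (truth ψ).1 (hy ψ hψ)))

end DeductionSystem

theorem theorem4p9 {K : Type u} (M : K → Unc.{u}) (T : UPFunctor K)
    (D : DeductionSystem M T) (hD : D.Lindenbaum) :
    (∃! α : Coalg M T D.canonId, D.IsCanonCoalg α) ∧
    ∀ α : Coalg M T D.canonId, D.IsCanonCoalg α →
      (∀ {S : UPFunctor K} (hS : S ∈ T.ing) (Γ : Set (Form M T false S)) (φ : Form M T false S),
        Form.Entails α Γ φ → D.Derives hS Γ φ) ∧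
      (∀ (Γ : Set (Form M T false .id)) (φ : Form M T false .id),
        Form.Entails α Γ φ ↔ D.Derives T.id_mem_ing Γ φ) ∧
      (D.Sound →
        ∀ {S : UPFunctor K} (hS : S ∈ T.ing) (Γ : Set (Form M T false S)) (φ : Form M T false S),
          Form.Entails α Γ φ ↔ D.Derives hS Γ φ) := by
  refine ⟨⟨_, DeductionSystem.isCanonCoalg_canonCoalg hD, fun α hα =>
    hα.unique (DeductionSystem.isCanonCoalg_canonCoalg hD)⟩, fun α hα => ⟨?_, ?_, ?_⟩⟩
  · exact fun hS Γ φ => hα.derives hD hS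
  · exact fun Γ φ => ⟨hα.derives hD _, hα.entails_id⟩
  · exact fun hs S hS Γ φ => ⟨hα.derives hD hS, fun h => hs hS Γ φ h _ α⟩
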